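/- Let $(M,g)$ be a smooth Riemannian manifold of dimension $n$ (without boundary), with Levi-Civita connection $\nabla$, curvature $R(X,Y)Z=\nabla_X\nabla_YZ-\nabla_Y\nabla_XZ-\nabla_{[X,Y]}Z$, Ricci tensor $Ric(Y,Z)=\operatorname{tr}(X\mapsto R(X,Y)Z)$ and scalar curvature $R=\operatorname{tr}_g Ric$. Let $\alpha,\beta,\lambda\in\mathbb{R}$ and let $f:M\to\mathbb{R}$ be a smooth function such that $(M,g)$ is a gradient Ricci–Yamabe soliton with potential function $f$, i.e. $$\alpha\, Ric+\nabla^2 f+\Big(\lambda-\frac{\beta}{2}R\Big)g=0,$$ where $\nabla^2 f$ is the Hessian of $f$. Then, everywhere on $M$, $$\alpha R+\Delta f+\Big(\lambda-\frac{\beta}{2}R\Big)n=0,$$ $$\{\alpha-\beta(n-1)\}\, g(\nabla R,\cdot)=2\,Ric(\nabla f,\cdot),$$ $$\{\alpha-\beta(n-1)\}\,\Delta R=g(\nabla R,\nabla f)-2\Big\{\alpha|Ric|^2+R\Big(\lambda-\frac{\beta}{2}R\Big)\Big\},$$ where $\Delta=\operatorname{tr}_g\nabla^2$ is the Laplace–Beltrami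 operator and $|Ric|$ is the norm of the Ricci tensor with respect to $g$. -/

import Mathlib

open Bundle Manifold
open scoped ContDiff

noncomputable section

namespace RiemGeom

variable {E : Type*} [NormedAddCommGroup E] [NormedSpace ℝ E] [FiniteDimensional ℝ E]
  {H : Type*} [TopologicalSpace H] (I : ModelWithCorners ℝ E H)
  {M : Type*} [TopologicalSpace M] [ChartedSpace H M] [IsManifold I ∞ M]
  [RiemannianBundle (fun x : M ↦ TangentSpace I x)]
  [IsContMDiffRiemannianBundle I ∞ E (fun x : M ↦ TangentSpace I x)]

instance finiteDimensional_tangentSpace (x : M) : FiniteDimensional ℝ (TangentSpace I x) :=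
  inferInstanceAs (FiniteDimensional ℝ E)

instance completeSpace_tangentSpace (x : M) : CompleteSpace (TangentSpace I x) :=
  FiniteDimensional.complete ℝ (TangentSpace I x)

/-- The Koszul expression: half of
`X g(Y,Z) + Y g(Z,X) - Z g(X,Y) + g([X,Y],Z) - g([X,Z],Y) - g([Y,Z],X)`, which is `g(∇_X Y, Z)`. -/
def koszul (X Y Z : Π x : M, TangentSpace I x) (x : M) : ℝ :=
  (1 / 2) * (mvfderiv I (fun y ↦ inner ℝ (Y y) (Z y)) x (X x)
    + mvfderiv I (fun y ↦ inner ℝ (Z y) (X y)) x (Y x)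
    - mvfderiv I (fun y ↦ inner ℝ (X y) (Y y)) x (Z x)
    + inner ℝ (VectorField.mlieBracket I X Y x) (Z x)
    - inner ℝ (VectorField.mlieBracket I X Z x) (Y x)
    - inner ℝ (VectorField.mlieBracket I Y Z x) (X x))

theorem mdifferentiableAt_inner {X Y : Π x : M, TangentSpace I x} {x : M}
    (hX : MDiffAt (T% X) x) (hY : MDiffAt (T% Y) x) :
    MDiffAt (fun y ↦ (inner ℝ (X y) (Y y) : ℝ)) x :=
  MDifferentiableAt.inner_bundle (E := fun x : M ↦ TangentSpace I x) hX hY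

theorem koszul_tensorial_left {Y Z : Π x : M, TangentSpace I x} {x : M}
    (hY : MDiffAt (T% Y) x) (hZ : MDiffAt (T% Z) x) :
    TensorialAt I E (fun X ↦ koszul I X Y Z x) x where
  smul {f X} hf hX := by
    have h1 := mvfderiv_fun_mul hf (mdifferentiableAt_inner I hZ hX)
    have h2 := mvfderiv_fun_mul hf (mdifferentiableAt_inner I hX hY)
    simp only [koszul, Pi.smul_apply', inner_smul_left, inner_smul_right,
      VectorField.mlieBracket_smul_left hf hX, inner_add_left, RCLike.conj_to_real] at *
    rw [h1, h2]
    simp [real_inner_comm]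
    ring
  add {X X'} hX hX' := by
    have h1 := mvfderiv_fun_add (mdifferentiableAt_inner I hZ hX) (mdifferentiableAt_inner I hZ hX')
    have h2 := mvfderiv_fun_add (mdifferentiableAt_inner I hX hY) (mdifferentiableAt_inner I hX' hY)
    simp only [koszul, Pi.add_apply, inner_add_left, inner_add_right,
      VectorField.mlieBracket_add_left hX hX'] at *
    rw [h1, h2]
    simp
    ring

theorem koszul_tensorial_right {X Y : Π x : M, TangentSpace I x} {x : M}
    (hX : MDiffAt (T% X) x) (hY : MDiffAt (T% Y) x) :
    TensorialAt I E (fun Z ↦ koszul I X Y Z x) x where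
  smul {f Z} hf hZ := by
    have h1 := mvfderiv_fun_mul hf (mdifferentiableAt_inner I hY hZ)
    have h2 := mvfderiv_fun_mul hf (mdifferentiableAt_inner I hZ hX)
    simp only [koszul, Pi.smul_apply', inner_smul_left, inner_smul_right,
      VectorField.mlieBracket_smul_right hf hZ, inner_add_left, RCLike.conj_to_real] at *
    rw [h1, h2]
    simp [real_inner_comm]
    ring
  add {Z Z'} hZ hZ' := by
    have h1 := mvfderiv_fun_add (mdifferentiableAt_inner I hY hZ) (mdifferentiableAt_inner I hY hZ')
    have h2 := mvfderiv_fun_add (mdifferentiableAt_inner I hZ hX) (mdifferentiableAt_inner I hZ' hX)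
    simp only [koszul, Pi.add_apply, inner_add_left, inner_add_right,
      VectorField.mlieBracket_add_right hZ hZ'] at *
    rw [h1, h2]
    simp
    ring

theorem koszul_smul_mid {f : M → ℝ} {X Y Z : Π x : M, TangentSpace I x} {x : M}
    (hf : MDiffAt f x) (hX : MDiffAt (T% X) x) (hY : MDiffAt (T% Y) x) (hZ : MDiffAt (T% Z) x) :
    koszul I X (f • Y) Z x =
      f x * koszul I X Y Z x + mvfderiv I f x (X x) * inner ℝ (Y x) (Z x) := by
  have h1 := mvfderiv_fun_mul hf (mdifferentiableAt_inner I hY hZ)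
  have h2 := mvfderiv_fun_mul hf (mdifferentiableAt_inner I hX hY)
  simp only [koszul, Pi.smul_apply', inner_smul_left, inner_smul_right,
    VectorField.mlieBracket_smul_right hf hY, VectorField.mlieBracket_smul_left hf hY,
    inner_add_left, RCLike.conj_to_real] at *
  rw [h1, h2]
  simp [real_inner_comm]
  ring

theorem koszul_add_mid {X Y Y' Z : Π x : M, TangentSpace I x} {x : M}
    (hX : MDiffAt (T% X) x) (hY : MDiffAt (T% Y) x) (hY' : MDiffAt (T% Y') x)
    (hZ : MDiffAt (T% Z) x) :
    koszul I X (Y + Y') Z x = koszul I X Y Z x + koszul I X Y' Z x := by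
  have h1 := mvfderiv_fun_add (mdifferentiableAt_inner I hY hZ) (mdifferentiableAt_inner I hY' hZ)
  have h2 := mvfderiv_fun_add (mdifferentiableAt_inner I hX hY) (mdifferentiableAt_inner I hX hY')
  simp only [koszul, Pi.add_apply, inner_add_left, inner_add_right,
    VectorField.mlieBracket_add_right hY hY', VectorField.mlieBracket_add_left hY hY'] at *
  rw [h1, h2]
  simp
  ring

open scoped Classical in
/-- The bilinear form `(v, z) ↦ g(∇_v Y, z)` on the tangent space at `x` given by the Koszul
formula (set to `0` when `Y` is not differentiable at `x`). -/
def koszulForm (Y : Π x : M, TangentSpace I x) (x : M) :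
    TangentSpace I x →L[ℝ] TangentSpace I x →L[ℝ] ℝ :=
  if hY : MDiffAt (T% Y) x then
    TensorialAt.mkHom₂ (fun X Z ↦ koszul I X Y Z x) x
      (fun _ hZ ↦ koszul_tensorial_left I hY hZ) (fun _ hX ↦ koszul_tensorial_right I hX hY)
  else 0

theorem koszulForm_apply {X Y Z : Π x : M, TangentSpace I x} {x : M}
    (hX : MDiffAt (T% X) x) (hY : MDiffAt (T% Y) x) (hZ : MDiffAt (T% Z) x) :
    koszulForm I Y x (X x) (Z x) = koszul I X Y Z x := by
  rw [koszulForm, dif_pos hY]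
  exact TensorialAt.mkHom₂_apply _ _ hX hZ

/-- The vector `∇_v Y` at `x`, linear in `v`, determined by the Koszul formula. -/
def leviCivitaAux (Y : Π x : M, TangentSpace I x) (x : M) :
    TangentSpace I x →L[ℝ] TangentSpace I x :=
  LinearMap.toContinuousLinearMap
    { toFun := fun v ↦ (InnerProductSpace.toDual ℝ (TangentSpace I x)).symm (koszulForm I Y x v)
      map_add' := fun v w ↦ by simp
      map_smul' := fun c v ↦ by simp }

theorem inner_leviCivitaAux (Y : Π x : M, TangentSpace I x) (x : M) (v z : TangentSpace I x) :
    inner ℝ (leviCivitaAux I Y x v) z = koszulForm I Y x v z :=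
  InnerProductSpace.toDual_symm_apply

theorem inner_leviCivitaAux_eq_koszul {X Y Z : Π x : M, TangentSpace I x} {x : M}
    (hX : MDiffAt (T% X) x) (hY : MDiffAt (T% Y) x) (hZ : MDiffAt (T% Z) x) :
    inner ℝ (leviCivitaAux I Y x (X x)) (Z x) = koszul I X Y Z x := by
  rw [inner_leviCivitaAux, koszulForm_apply I hX hY hZ]

theorem leviCivitaAux_eq_of_koszul {Y : Π x : M, TangentSpace I x} {x : M}
    (hY : MDiffAt (T% Y) x) (A : TangentSpace I x →L[ℝ] TangentSpace I x)
    (h : ∀ X Z : Π x : M, TangentSpace I x, MDiffAt (T% X) x → MDiffAt (T% Z) x →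
      koszul I X Y Z x = inner ℝ (A (X x)) (Z x)) :
    leviCivitaAux I Y x = A := by
  ext v
  refine ext_inner_right ℝ fun z ↦ ?_
  have hv := FiberBundle.extend_apply_self (F := E) v
  have hz := FiberBundle.extend_apply_self (F := E) z
  have hX := FiberBundle.mdifferentiableAt_extend I E v
  have hZ := FiberBundle.mdifferentiableAt_extend I E z
  have := inner_leviCivitaAux_eq_koszul I hX hY hZ
  rw [h _ _ hX hZ, hv, hz] at this
  exact this

/-- The Levi-Civita connection of the Riemannian metric. As in Mathlib, `leviCivita I Y x v` is
`∇_v Y` at `x`. -/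
def leviCivita : CovariantDerivative I E (fun x : M ↦ TangentSpace I x) where
  toFun := leviCivitaAux I
  isCovariantDerivativeOnUniv :=
    { add := by
        intro Y Y' x hY hY' _
        refine leviCivitaAux_eq_of_koszul I (mdifferentiableAt_add_section hY hY') _ ?_
        intro X Z hX hZ
        rw [koszul_add_mid I hX hY hY' hZ, add_apply, inner_add_left,
          inner_leviCivitaAux_eq_koszul I hX hY hZ, inner_leviCivitaAux_eq_koszul I hX hY' hZ]
      leibniz := by
        intro Y f x hY hf _
        refine leviCivitaAux_eq_of_koszul I (hf.smul_section hY) _ ?_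
        intro X Z hX hZ
        rw [koszul_smul_mid I hf hX hY hZ, add_apply, inner_add_left,
          smul_apply, real_inner_smul_left,
          inner_leviCivitaAux_eq_koszul I hX hY hZ]
        simp [inner_smul_left] }

theorem leviCivita_isMetricCompatible :
    CovariantDerivative.IsMetricCompatible (V := fun x : M ↦ TangentSpace I x) (leviCivita I) := by
  rw [CovariantDerivative.isMetricCompatible_iff]
  intro x X Y Z hX hY hZ
  change _ = inner ℝ (leviCivitaAux I Y x (X x)) (Z x) + inner ℝ (Y x) (leviCivitaAux I Z x (X x))
  rw [real_inner_comm (leviCivitaAux I Z x (X x)), inner_leviCivitaAux_eq_koszul I hX hY hZ,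
    inner_leviCivitaAux_eq_koszul I hX hZ hY]
  simp only [koszul]
  rw [VectorField.mlieBracket_swap_apply (V := Z) (W := Y)]
  simp [real_inner_comm]
  ring

theorem leviCivita_torsion : (leviCivita I (M := M)).torsion = 0 := by
  rw [CovariantDerivative.torsion_eq_zero_iff]
  intro X Y x hX hY
  change leviCivitaAux I Y x (X x) - leviCivitaAux I X x (Y x) = _
  refine ext_inner_right ℝ fun z ↦ ?_
  have hz := FiberBundle.extend_apply_self (F := E) z
  have hZ := FiberBundle.mdifferentiableAt_extend I E z
  rw [← hz, inner_sub_left, inner_leviCivitaAux_eq_koszul I hX hY hZ,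
    inner_leviCivitaAux_eq_koszul I hY hX hZ]
  simp only [koszul]
  rw [VectorField.mlieBracket_swap_apply (V := Y) (W := X)]
  simp [real_inner_comm]
  ring

/-- The curvature `R(X,Y)Z = ∇_X ∇_Y Z - ∇_Y ∇_X Z - ∇_[X,Y] Z` of vector fields. -/
def curvature (X Y Z : Π x : M, TangentSpace I x) (x : M) : TangentSpace I x :=
  leviCivita I (fun y ↦ leviCivita I Z y (Y y)) x (X x)
    - leviCivita I (fun y ↦ leviCivita I Z y (X y)) x (Y x)
    - leviCivita I Z x (VectorField.mlieBracket I X Y x)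

/-- The Riemann curvature tensor `R(u,v)w` at `x`, computed on extensions of `u`, `v`, `w` to
vector fields that are smooth near `x`. -/
def riemann (x : M) (u v w : TangentSpace I x) : TangentSpace I x :=
  curvature I (FiberBundle.extend E u) (FiberBundle.extend E v) (FiberBundle.extend E w) x

/-- The Ricci tensor `Ric(v,w) = tr (u ↦ R(u,v)w)`, the trace taken in an orthonormal basis. -/
def ricci (x : M) (v w : TangentSpace I x) : ℝ :=
  let e := stdOrthonormalBasis ℝ (TangentSpace I x)
  ∑ i, inner ℝ (riemann I x (e i) v w) (e i)

/-- The scalar curvature `R = tr_g Ric`. -/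
def scalarCurvature (x : M) : ℝ :=
  let e := stdOrthonormalBasis ℝ (TangentSpace I x)
  ∑ i, ricci I x (e i) (e i)

/-- The squared norm `|Ric|²` of the Ricci tensor. -/
def ricciNormSq (x : M) : ℝ :=
  let e := stdOrthonormalBasis ℝ (TangentSpace I x)
  ∑ i, ∑ j, ricci I x (e i) (e j) ^ 2

/-- The gradient of a function: `g(∇f, v) = df(v)`. -/
def grad (f : M → ℝ) (x : M) : TangentSpace I x :=
  (InnerProductSpace.toDual ℝ (TangentSpace I x)).symm (mvfderiv I f x)

/-- The Hessian `∇²f(v,w) = g(∇_v ∇f, w)`. -/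
def hessian (f : M → ℝ) (x : M) (v w : TangentSpace I x) : ℝ :=
  inner ℝ (leviCivita I (grad I f) x v) w

/-- The Laplacian `Δf = tr_g ∇²f = div ∇f`. -/
def laplacian (f : M → ℝ) (x : M) : ℝ :=
  let e := stdOrthonormalBasis ℝ (TangentSpace I x)
  ∑ i, hessian I f x (e i) (e i)

/-- `(M, g)` is a gradient Ricci-Yamabe soliton with potential function `f` and constants
`α`, `β`, `lam`: `f` is smooth and `α Ric + ∇²f + (lam - β R / 2) g = 0`. -/
structure IsGradientRicciYamabeSoliton (α β lam : ℝ) (f : M → ℝ) : Prop where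
  smooth : ContMDiff I 𝓘(ℝ, ℝ) ∞ f
  soliton_eq : ∀ (x : M) (v w : TangentSpace I x),
    α * ricci I x v w + hessian I f x v w
      + (lam - β / 2 * scalarCurvature I x) * inner ℝ v w = 0

end RiemGeom

end

set_option linter.unusedSectionVars false

noncomputable section

namespace RiemGeom

open Filter Topology

variable {E : Type*} [NormedAddCommGroup E] [NormedSpace ℝ E] [FiniteDimensional ℝ E]
  {H : Type*} [TopologicalSpace H] {I : ModelWithCorners ℝ E H}
  {M : Type*} [TopologicalSpace M] [ChartedSpace H M] [IsManifold I ∞ M]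
  [RiemannianBundle (fun x : M ↦ TangentSpace I x)]
  [IsContMDiffRiemannianBundle I ∞ E (fun x : M ↦ TangentSpace I x)]

section Smoothness

variable {X Y Z W : Π x : M, TangentSpace I x} {f g : M → ℝ} {x : M}

/-- The directional derivative `X f` of a function along a vector field. -/
def dirDeriv (X : Π x : M, TangentSpace I x) (f : M → ℝ) (x : M) : ℝ := mvfderiv I f x (X x)

/-- The covariant derivative `∇_X Y` of vector fields. -/
def nabla (X Y : Π x : M, TangentSpace I x) (x : M) : TangentSpace I x := leviCivita I Y x (X x)

theorem natCast_le_infty (k : ℕ) : ((k : ℕ∞) : WithTop ℕ∞) ≤ ∞ := by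
  exact_mod_cast le_top

theorem two_le_infty : (2 : WithTop ℕ∞) ≤ ∞ := natCast_le_infty 2

theorem mdifferentiableAt_of_smooth {N : Type*} [TopologicalSpace N] {E' : Type*}
    [NormedAddCommGroup E'] [NormedSpace ℝ E'] {H' : Type*} [TopologicalSpace H']
    {J : ModelWithCorners ℝ E' H'} [ChartedSpace H' N] {f : M → N}
    (hf : CMDiffAt ∞ f x) : MDiffAt f x :=
  hf.mdifferentiableAt (by simp)

theorem eventually_mdifferentiableAt (hX : CMDiffAt ∞ (T% X) x) :
    ∀ᶠ y in 𝓝 x, MDiffAt (T% X) y := by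
  have h1 : CMDiffAt 1 (T% X) x := hX.of_le (by simp)
  filter_upwards [(contMDiffAt_iff_contMDiffAt_nhds (by simp)).1 h1] with y hy
  exact hy.mdifferentiableAt (by simp)

theorem eventually_mdifferentiableAt_fun (hf : CMDiffAt ∞ f x) :
    ∀ᶠ y in 𝓝 x, MDiffAt f y := by
  have h1 : CMDiffAt 1 f x := hf.of_le (by simp)
  filter_upwards [(contMDiffAt_iff_contMDiffAt_nhds (by simp)).1 h1] with y hy
  exact hy.mdifferentiableAt (by simp)

theorem contMDiffAt_dirDeriv (hX : CMDiffAt ∞ (T% X) x) (hf : CMDiffAt ∞ f x) :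
    CMDiffAt ∞ (dirDeriv X f) x := by
  have h1 := hf.mfderiv_const (m := ∞) (by simp)
  have h2 := ContMDiffAt.clm_apply_of_inCoordinates (b₁ := id) (b₂ := f) (n := ∞) (m₀ := x)
    (F₁ := E) (F₂ := ℝ) (E₁ := fun x : M ↦ TangentSpace I x)
    (E₂ := fun x : ℝ ↦ TangentSpace 𝓘(ℝ, ℝ) x)
    (ϕ := fun m ↦ mfderiv I 𝓘(ℝ, ℝ) f m) (v := X) h1 hX hf
  rw [contMDiffAt_totalSpace] at h2
  have h3 := h2.2
  simp only [id_eq, trivializationAt_model_space_apply] at h3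
  exact h3

theorem contMDiffAt_mlieBracket (hX : CMDiffAt ∞ (T% X) x) (hY : CMDiffAt ∞ (T% Y) x) :
    CMDiffAt ∞ (T% (VectorField.mlieBracket I X Y)) x := by
  have : IsManifold I ((⊤ : ℕ∞) + 1) M := by simpa
  have : IsManifold I (minSmoothness ℝ 2) M := by
    rw [minSmoothness_of_isRCLikeNormedField]
    exact IsManifold.of_le (n := ∞) two_le_infty
  exact ContMDiffAt.mlieBracket_vectorField (m := ⊤) (n := ⊤) hX hY (by simp)

theorem contMDiffAt_inner (hX : CMDiffAt ∞ (T% X) x) (hY : CMDiffAt ∞ (T% Y) x) :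
    CMDiffAt ∞ (fun y ↦ (inner ℝ (X y) (Y y) : ℝ)) x :=
  ContMDiffAt.inner_bundle (E := fun x : M ↦ TangentSpace I x) hX hY

theorem contMDiffAt_koszul (hX : CMDiffAt ∞ (T% X) x) (hY : CMDiffAt ∞ (T% Y) x)
    (hZ : CMDiffAt ∞ (T% Z) x) : CMDiffAt ∞ (koszul I X Y Z) x := by
  have h1 := contMDiffAt_dirDeriv hX (contMDiffAt_inner hY hZ)
  have h2 := contMDiffAt_dirDeriv hY (contMDiffAt_inner hZ hX)
  have h3 := contMDiffAt_dirDeriv hZ (contMDiffAt_inner hX hY)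
  have h4 := contMDiffAt_inner (contMDiffAt_mlieBracket hX hY) hZ
  have h5 := contMDiffAt_inner (contMDiffAt_mlieBracket hX hZ) hY
  have h6 := contMDiffAt_inner (contMDiffAt_mlieBracket hY hZ) hX
  exact contMDiffAt_const.mul (((((h1.add h2).sub h3).add h4).sub h5).sub h6)

end Smoothness

section Rules

variable {X X' Y Y' Z W : Π x : M, TangentSpace I x} {f g : M → ℝ} {x : M}

theorem dirDeriv_congr (h : f =ᶠ[𝓝 x] g) : dirDeriv X f x = dirDeriv X g x := by
  simp only [dirDeriv, mvfderiv]
  rw [h.mfderiv_eq, h.self_of_nhds]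

theorem dirDeriv_add (hf : MDiffAt f x) (hg : MDiffAt g x) :
    dirDeriv X (fun y ↦ f y + g y) x = dirDeriv X f x + dirDeriv X g x := by
  simp [dirDeriv, mvfderiv_fun_add hf hg]

theorem dirDeriv_mul (hf : MDiffAt f x) (hg : MDiffAt g x) :
    dirDeriv X (fun y ↦ f y * g y) x = f x * dirDeriv X g x + g x * dirDeriv X f x := by
  simp [dirDeriv, mvfderiv_fun_mul hf hg]

theorem dirDeriv_const (c : ℝ) : dirDeriv X (fun _ ↦ c) x = 0 := by
  simp [dirDeriv, mvfderiv_const]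

theorem dirDeriv_sum {ι : Type*} (s : Finset ι) {F : ι → M → ℝ} (hF : ∀ i ∈ s, MDiffAt (F i) x) :
    MDiffAt (fun y ↦ ∑ i ∈ s, F i y) x ∧
      dirDeriv X (fun y ↦ ∑ i ∈ s, F i y) x = ∑ i ∈ s, dirDeriv X (F i) x := by
  classical
  induction s using Finset.induction_on with
  | empty => simp [dirDeriv_const, mdifferentiableAt_const]
  | insert a s ha ih =>
    simp only [Finset.mem_insert, forall_eq_or_imp] at hF
    obtain ⟨h1, h2⟩ := ih hF.2
    simp only [Finset.sum_insert ha]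
    exact ⟨hF.1.add h1, by rw [dirDeriv_add hF.1 h1, h2]⟩

theorem nabla_congr (hY : MDiffAt (T% Y) x) (hY' : MDiffAt (T% Y') x) (h : Y =ᶠ[𝓝 x] Y') :
    nabla X Y x = nabla X Y' x := by
  simp only [nabla]
  rw [((leviCivita I).isCovariantDerivativeOn (s := Set.univ)).congr_of_eventuallyEq hY hY'
    univ_mem h]

theorem nabla_vec_add : nabla (X + X') Y = nabla X Y + nabla X' Y := by
  ext; simp [nabla]

theorem nabla_vec_neg : nabla (-X) Y = -nabla X Y := by
  ext; simp [nabla]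

theorem nabla_vec_smul : nabla (f • X) Y = f • nabla X Y := by
  ext; simp [nabla]

theorem nabla_vec_eq_zero (h : X x = 0) : nabla X Y x = 0 := by
  simp [nabla, h]

theorem nabla_add (hY : MDiffAt (T% Y) x) (hY' : MDiffAt (T% Y') x) :
    nabla X (Y + Y') x = nabla X Y x + nabla X Y' x := by
  simp [nabla, ((leviCivita I).isCovariantDerivativeOnUniv).add hY hY']

theorem nabla_smul (hf : MDiffAt f x) (hY : MDiffAt (T% Y) x) :
    nabla X (f • Y) x = f x • nabla X Y x + dirDeriv X f x • Y x := by
  simp [nabla, dirDeriv, ((leviCivita I).isCovariantDerivativeOnUniv).leibniz hY hf]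

theorem nabla_sub (hY : MDiffAt (T% Y) x) (hY' : MDiffAt (T% Y') x) :
    nabla X (Y - Y') x = nabla X Y x - nabla X Y' x := by
  have h : MDiffAt (T% (Y - Y')) x := mdifferentiableAt_sub_section hY hY'
  have := nabla_add (X := X) h hY'
  rw [sub_add_cancel] at this
  rw [this, add_sub_cancel_right]

theorem dirDeriv_inner (hY : MDiffAt (T% Y) x) (hZ : MDiffAt (T% Z) x) :
    dirDeriv X (fun y ↦ inner ℝ (Y y) (Z y)) x =
      inner ℝ (nabla X Y x) (Z x) + inner ℝ (Y x) (nabla X Z x) :=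
  (leviCivita_isMetricCompatible (I := I) (M := M)).mvfderiv_inner_eq X hY hZ

theorem nabla_sub_nabla (hX : MDiffAt (T% X) x) (hY : MDiffAt (T% Y) x) :
    nabla X Y x - nabla Y X x = VectorField.mlieBracket I X Y x :=
  CovariantDerivative.torsion_eq_zero_iff (leviCivita I) |>.1 (leviCivita_torsion I) hX hY

theorem mlieBracket_leibniz (hX : CMDiffAt ∞ (T% X) x) (hY : CMDiffAt ∞ (T% Y) x)
    (hZ : CMDiffAt ∞ (T% Z) x) :
    VectorField.mlieBracket I X (VectorField.mlieBracket I Y Z) x =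
      VectorField.mlieBracket I (VectorField.mlieBracket I X Y) Z x +
      VectorField.mlieBracket I Y (VectorField.mlieBracket I X Z) x := by
  have : IsManifold I (minSmoothness ℝ 3) M := by
    rw [minSmoothness_of_isRCLikeNormedField]
    exact IsManifold.of_le (n := ∞) (natCast_le_infty 3)
  have h2 : minSmoothness ℝ 2 ≤ (∞ : WithTop ℕ∞) := by
    rw [minSmoothness_of_isRCLikeNormedField]
    exact two_le_infty
  exact VectorField.leibniz_identity_mlieBracket_apply (hX.of_le h2) (hY.of_le h2) (hZ.of_le h2)

end Rules

section Frame

variable {x : M}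

theorem nabla_sum {ι : Type*} (s : Finset ι) {X : Π x : M, TangentSpace I x}
    {Y : ι → Π x : M, TangentSpace I x} (hY : ∀ i ∈ s, MDiffAt (T% (Y i)) x) :
    MDiffAt (T% (∑ i ∈ s, Y i)) x ∧ nabla X (∑ i ∈ s, Y i) x = ∑ i ∈ s, nabla X (Y i) x := by
  classical
  induction s using Finset.induction_on with
  | empty =>
    refine ⟨mdifferentiableAt_zeroSection .., ?_⟩
    simp [nabla, CovariantDerivative.zero]
  | insert a s ha ih =>
    simp only [Finset.mem_insert, forall_eq_or_imp] at hY
    obtain ⟨h1, h2⟩ := ih hY.2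
    simp only [Finset.sum_insert ha]
    exact ⟨mdifferentiableAt_add_section hY.1 h1, by rw [nabla_add hY.1 h1, h2]⟩

theorem contMDiffAt_sum {ι : Type*} (s : Finset ι) {Y : ι → Π x : M, TangentSpace I x}
    (hY : ∀ i ∈ s, CMDiffAt ∞ (T% (Y i)) x) : CMDiffAt ∞ (T% (∑ i ∈ s, Y i)) x := by
  have := ContMDiffAt.sum_section hY
  simpa only [← Finset.sum_apply] using! this

theorem eventually_contMDiffAt_extend (v : TangentSpace I x) :
    ∀ᶠ y in 𝓝 x, CMDiffAt ∞ (T% (FiberBundle.extend E v)) y := by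
  obtain ⟨s, hs, h⟩ := FiberBundle.exists_contMDiffOn_extend (k := ∞) I E v
  filter_upwards [eventually_mem_nhds_iff.2 hs] with y hy
  exact h.contMDiffAt hy

/-- Every covector at a point is the differential of a function which is smooth near the point
and vanishes there. -/
theorem exists_mvfderiv_eq (x : M) (L : TangentSpace I x →L[ℝ] ℝ) :
    ∃ φ : M → ℝ, (∀ᶠ y in 𝓝 x, CMDiffAt ∞ φ y) ∧ φ x = 0 ∧ mvfderiv I φ x = L := by
  have hinv := isInvertible_mfderiv_extChartAt (I := I) (mem_extChartAt_source (I := I) x)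
  obtain ⟨A, hA⟩ := hinv
  let A' : TangentSpace I x ≃L[ℝ] E := A
  let L' : E →L[ℝ] ℝ := L ∘L (A'.symm : E →L[ℝ] TangentSpace I x)
  have hg : MDifferentiableAt 𝓘(ℝ, E) 𝓘(ℝ, ℝ) (fun z ↦ L' (z - extChartAt I x x))
      (extChartAt I x x) := by
    apply DifferentiableAt.mdifferentiableAt
    fun_prop
  have hchart : ∀ᶠ y in 𝓝 x, CMDiffAt ∞ (extChartAt I x) y := by
    filter_upwards [(chartAt H x).open_source.mem_nhds (mem_chart_source H x)] with y hy
    exact contMDiffAt_extChartAt' hy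
  have hf : MDiffAt (extChartAt I x) x := mdifferentiableAt_of_smooth hchart.self_of_nhds
  refine ⟨fun y ↦ L' (extChartAt I x y - extChartAt I x x), ?_, by simp, ?_⟩
  · filter_upwards [hchart] with y hy
    have : ContDiff ℝ ∞ (fun z ↦ L' (z - extChartAt I x x)) := by fun_prop
    exact this.contDiffAt.contMDiffAt.comp y hy
  · have h1 := mvfderiv_comp (I' := I) x hg hf
    have h2 : mvfderiv 𝓘(ℝ, E) (fun z ↦ L' (z - extChartAt I x x)) (extChartAt I x x) = L' := by
      have : HasFDerivAt (fun z ↦ L' (z - extChartAt I x x)) L' (extChartAt I x x) := by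
        have := L'.hasFDerivAt.comp (extChartAt I x x)
          ((hasFDerivAt_id _).sub_const (extChartAt I x x))
        rwa [ContinuousLinearMap.comp_id] at this
      ext v
      have h3 := this.fderiv
      rw [← mfderiv_eq_fderiv] at h3
      exact congrArg (fun T : E →L[ℝ] ℝ ↦ T v) h3
    rw [h2, ← hA] at h1
    refine h1.trans ?_
    ext v
    exact congrArg L (A'.symm_apply_apply v)

/-- Every tangent vector extends to a smooth vector field with vanishing covariant derivative at
the base point. -/
theorem exists_parallel_extension (v : TangentSpace I x) :
    ∃ S : Π x : M, TangentSpace I x, (∀ᶠ y in 𝓝 x, CMDiffAt ∞ (T% S) y) ∧ S x = v ∧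
      ∀ X : Π x : M, TangentSpace I x, nabla X S x = 0 := by
  let b := stdOrthonormalBasis ℝ (TangentSpace I x)
  let Z : Π x : M, TangentSpace I x := FiberBundle.extend E v
  let B (j) : Π x : M, TangentSpace I x := FiberBundle.extend E (b j)
  choose φ hφ hφ0 hφ' using fun j ↦
    exists_mvfderiv_eq x ((innerSL ℝ (b j)).comp (leviCivita I Z x))
  have hφB (j) : MDiffAt (T% (φ j • B j)) x :=
    mdifferentiableAt_of_smooth ((hφ j).self_of_nhds.smul_section
      (eventually_contMDiffAt_extend (b j)).self_of_nhds)
  have hZ := eventually_contMDiffAt_extend v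
  refine ⟨Z - ∑ j, φ j • B j, ?_, ?_, fun X ↦ ?_⟩
  · filter_upwards [hZ, eventually_all.2 hφ,
      eventually_all.2 fun j ↦ eventually_contMDiffAt_extend (b j)] with y h1 h2 h3
    exact h1.sub_section (contMDiffAt_sum _ fun j _ ↦ (h2 j).smul_section (h3 j))
  · simp [hφ0, Z]
  · rw [nabla_sub (mdifferentiableAt_of_smooth hZ.self_of_nhds) (nabla_sum (X := X) _ fun j _ ↦ hφB j).1,
      (nabla_sum (X := X) _ fun j _ ↦ hφB j).2, sub_eq_zero]
    have key (j) : nabla X (φ j • B j) x = inner ℝ (b j) (nabla X Z x) • b j := by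
      rw [nabla_smul (mdifferentiableAt_of_smooth (hφ j).self_of_nhds)
        (mdifferentiableAt_of_smooth (eventually_contMDiffAt_extend (b j)).self_of_nhds), hφ0, FiberBundle.extend_apply_self (F := E)]
      simp [dirDeriv, hφ', nabla]
    simp_rw [key]
    exact (b.sum_repr' _).symm

end Frame

section OrthonormalFrame

variable {x : M}

theorem dirDeriv_eq_zero_of_mul {X : Π x : M, TangentSpace I x} {c b : M → ℝ}
    (hc : MDiffAt c x) (hb : MDiffAt b x) (hb0 : b x ≠ 0) (h : dirDeriv X b x = 0)
    (h' : dirDeriv X (fun y ↦ c y * b y) x = 0) : dirDeriv X c x = 0 := by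
  rw [dirDeriv_mul hc hb, h] at h'
  simpa [hb0] using h'

theorem dirDeriv_inner_eq_zero {X Y Z : Π x : M, TangentSpace I x}
    (hY : MDiffAt (T% Y) x) (hZ : MDiffAt (T% Z) x) (hY' : nabla X Y x = 0)
    (hZ' : nabla X Z x = 0) : dirDeriv X (fun y ↦ inner ℝ (Y y) (Z y)) x = 0 := by
  rw [dirDeriv_inner hY hZ, hY', hZ']
  simp

theorem contMDiffAt_inv_norm {Y : Π x : M, TangentSpace I x} (hY : CMDiffAt ∞ (T% Y) x)
    (h : Y x ≠ 0) : CMDiffAt ∞ (fun y ↦ ‖Y y‖⁻¹) x := by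
  have h1 : ContDiffAt ℝ ∞ (fun t : ℝ ↦ (√t)⁻¹) (inner ℝ (Y x) (Y x)) := by
    have h0 : (inner ℝ (Y x) (Y x) : ℝ) ≠ 0 := inner_self_ne_zero.2 h
    refine (Real.contDiffAt_sqrt h0).inv ?_
    rw [← norm_eq_sqrt_real_inner]
    exact norm_ne_zero_iff.2 h
  have h2 := h1.contMDiffAt.comp x (contMDiffAt_inner hY hY)
  refine h2.congr_of_eventuallyEq (Eventually.of_forall fun y ↦ ?_)
  simp only [Function.comp_apply]
  rw [← norm_eq_sqrt_real_inner]

theorem eventually_ne_zero {Y : Π x : M, TangentSpace I x} (hY : CMDiffAt ∞ (T% Y) x)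
    (h : Y x ≠ 0) : ∀ᶠ y in 𝓝 x, Y y ≠ 0 := by
  have h1 := (contMDiffAt_inner hY hY).continuousAt.eventually_ne (inner_self_ne_zero.2 h)
  filter_upwards [h1] with y hy
  exact inner_self_ne_zero.1 hy

/-- Gram-Schmidt orthogonalisation of smooth fields that are orthonormal and parallel at a point. -/
theorem gramSchmidt_smooth_parallel {n : ℕ} (s : Fin n → Π x : M, TangentSpace I x)
    (hs : ∀ i, ∀ᶠ y in 𝓝 x, CMDiffAt ∞ (T% (s i)) y) (hon : Orthonormal ℝ fun i ↦ s i x)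
    (hpar : ∀ i, ∀ X : Π x : M, TangentSpace I x, nabla X (s i) x = 0) (i : Fin n) :
    let G (i : Fin n) : Π y : M, TangentSpace I y :=
      fun y ↦ InnerProductSpace.gramSchmidt ℝ (fun i ↦ s i y) i
    (∀ᶠ y in 𝓝 x, CMDiffAt ∞ (T% (G i)) y) ∧
      (∀ X : Π x : M, TangentSpace I x, nabla X (G i) x = 0) := by
  intro G
  have hGx (i) : G i x = s i x :=
    congrFun (InnerProductSpace.gramSchmidt_of_orthogonal ℝ hon.2) i
  have hG0 (i) : G i x ≠ 0 := by rw [hGx]; exact hon.ne_zero i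
  induction i using WellFoundedLT.induction with
  | ind i ih =>
    let b (j : Fin n) (y : M) : ℝ := inner ℝ (G j y) (G j y)
    let a (j : Fin n) (y : M) : ℝ := inner ℝ (G j y) (s i y)
    let c (j : Fin n) (y : M) : ℝ := a j y / b j y
    have hG : G i = s i - ∑ j ∈ Finset.Iio i, c j • G j := by
      ext1 y
      have := InnerProductSpace.gramSchmidt_def'' ℝ (fun i ↦ s i y) i
      rw [Pi.sub_apply, Finset.sum_apply, eq_sub_iff_add_eq]
      refine Eq.trans ?_ this.symm
      congr 1
      refine Finset.sum_congr rfl fun j _ ↦ ?_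
      simp only [c, a, b, G, Pi.smul_apply', real_inner_self_eq_norm_sq]
      rfl
    have hb0 (j) : b j x ≠ 0 := inner_self_ne_zero.2 (hG0 j)
    have hc (j) (hj : j ∈ Finset.Iio i) : ∀ᶠ y in 𝓝 x, CMDiffAt ∞ (c j) y := by
      have hGj := (ih j (Finset.mem_Iio.1 hj)).1
      filter_upwards [hGj, hs i, eventually_ne_zero hGj.self_of_nhds (hG0 j)] with y h1 h2 h3
      exact (contMDiffAt_inner h1 h2).div₀ (contMDiffAt_inner h1 h1) (inner_self_ne_zero.2 h3)
    have hcG (j) (hj : j ∈ Finset.Iio i) : ∀ᶠ y in 𝓝 x, CMDiffAt ∞ (T% (c j • G j)) y := by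
      filter_upwards [hc j hj, (ih j (Finset.mem_Iio.1 hj)).1] with y h1 h2
      exact h1.smul_section h2
    rw [hG]
    constructor
    · filter_upwards [hs i, (Finset.eventually_all _).2 hcG] with y h1 h2
      exact h1.sub_section (contMDiffAt_sum _ h2)
    · intro X
      have hd (j) (hj : j ∈ Finset.Iio i) : MDiffAt (T% (c j • G j)) x :=
        mdifferentiableAt_of_smooth (hcG j hj).self_of_nhds
      obtain ⟨h1, h2⟩ := nabla_sum (X := X) _ hd
      rw [nabla_sub (mdifferentiableAt_of_smooth (hs i).self_of_nhds) h1, h2, hpar, zero_sub,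
        neg_eq_zero]
      refine Finset.sum_eq_zero fun j hj ↦ ?_
      obtain ⟨hGj, hGj'⟩ := ih j (Finset.mem_Iio.1 hj)
      have mG : MDiffAt (T% (G j)) x := mdifferentiableAt_of_smooth hGj.self_of_nhds
      have mc : MDiffAt (c j) x := mdifferentiableAt_of_smooth (hc j hj).self_of_nhds
      have ms : MDiffAt (T% (s i)) x := mdifferentiableAt_of_smooth (hs i).self_of_nhds
      rw [nabla_smul mc mG, hGj']
      have hcb : (fun y ↦ c j y * b j y) =ᶠ[𝓝 x] a j := by
        filter_upwards [eventually_ne_zero hGj.self_of_nhds (hG0 j)] with y h3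
        exact div_mul_cancel₀ _ (inner_self_ne_zero.2 h3)
      rw [dirDeriv_eq_zero_of_mul mc (mdifferentiableAt_inner I mG mG) (hb0 j)
        (dirDeriv_inner_eq_zero mG mG (hGj' X) (hGj' X))]
      · simp
      · rw [dirDeriv_congr hcb]
        exact dirDeriv_inner_eq_zero mG ms (hGj' X) (hpar i X)

/-- A family of vector fields which is smooth and orthonormal near `x` and parallel at `x`. -/
structure IsGeodesicFrame {ι : Type*} (x : M) (e : ι → Π x : M, TangentSpace I x) : Prop where
  smooth : ∀ᶠ y in 𝓝 x, ∀ i, CMDiffAt ∞ (T% (e i)) y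
  orthonormal : ∀ᶠ y in 𝓝 x, Orthonormal ℝ fun i ↦ e i y
  parallel : ∀ i, ∀ X : Π x : M, TangentSpace I x, nabla X (e i) x = 0

theorem finrank_tangentSpace (x : M) :
    Module.finrank ℝ (TangentSpace I x) = Module.finrank ℝ E := rfl

theorem exists_isGeodesicFrame (x : M) :
    ∃ e : Fin (Module.finrank ℝ E) → Π x : M, TangentSpace I x, IsGeodesicFrame x e := by
  let b := stdOrthonormalBasis ℝ (TangentSpace I x)
  choose s hs hsx hpar using fun i ↦ exists_parallel_extension (b i)
  have hon : Orthonormal ℝ fun i ↦ s i x := by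
    simp_rw [hsx]
    exact b.orthonormal
  let G (i) : Π y : M, TangentSpace I y :=
    fun y ↦ InnerProductSpace.gramSchmidt ℝ (fun i ↦ s i y) i
  have hG (i) : (∀ᶠ y in 𝓝 x, CMDiffAt ∞ (T% (G i)) y) ∧
      (∀ X : Π x : M, TangentSpace I x, nabla X (G i) x = 0) :=
    gramSchmidt_smooth_parallel s hs hon hpar i
  have hGx (i) : G i x = s i x :=
    congrFun (InnerProductSpace.gramSchmidt_of_orthogonal ℝ hon.2) i
  have hG0 (i) : G i x ≠ 0 := by rw [hGx]; exact hon.ne_zero i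
  have hGne (i) := eventually_ne_zero (hG i).1.self_of_nhds (hG0 i)
  let r (i) (y : M) : ℝ := ‖G i y‖⁻¹
  have hr (i) : ∀ᶠ y in 𝓝 x, CMDiffAt ∞ (r i) y := by
    filter_upwards [(hG i).1, hGne i] with y h1 h2
    exact contMDiffAt_inv_norm h1 h2
  refine ⟨fun i ↦ r i • G i, ?_, ?_, fun i X ↦ ?_⟩
  · filter_upwards [eventually_all.2 hr, eventually_all.2 fun i ↦ (hG i).1] with y h1 h2 i
    exact (h1 i).smul_section (h2 i)
  · filter_upwards [eventually_all.2 hGne] with y hy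
    refine ⟨fun i ↦ ?_, fun i j hij ↦ ?_⟩
    · simp [r, norm_smul, hy i]
    · have : inner ℝ (G i y) (G j y) = 0 :=
        InnerProductSpace.gramSchmidt_orthogonal ℝ (fun i ↦ s i y) hij
      simp [inner_smul_left, inner_smul_right, this]
  · have mG : MDiffAt (T% (G i)) x := mdifferentiableAt_of_smooth (hG i).1.self_of_nhds
    have mr : MDiffAt (r i) x := mdifferentiableAt_of_smooth (hr i).self_of_nhds
    rw [nabla_smul mr mG, (hG i).2]
    have hrr : dirDeriv X (fun y ↦ r i y * r i y) x = 0 := by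
      refine dirDeriv_eq_zero_of_mul (mr.mul mr) (mdifferentiableAt_inner I mG mG)
        (inner_self_ne_zero.2 (hG0 i)) (dirDeriv_inner_eq_zero mG mG ((hG i).2 X) ((hG i).2 X)) ?_
      rw [dirDeriv_congr (g := fun _ ↦ 1), dirDeriv_const]
      filter_upwards [hGne i] with y hy
      have : ‖G i y‖ ≠ 0 := norm_ne_zero_iff.2 hy
      simp only [r, real_inner_self_eq_norm_sq]
      field_simp
    have hr0 : r i x ≠ 0 := inv_ne_zero (norm_ne_zero_iff.2 (hG0 i))
    have : dirDeriv X (r i) x = 0 := by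
      rw [dirDeriv_mul mr mr] at hrr
      have h2 : r i x * dirDeriv X (r i) x = 0 := by linarith
      exact (mul_eq_zero.1 h2).resolve_left hr0
    simp [this]

end OrthonormalFrame

section Curvature

open VectorField

variable {X X' Y Z Z' W : Π x : M, TangentSpace I x} {f g : M → ℝ} {x : M}

theorem exists_orthonormalBasis_eq {e : Fin (Module.finrank ℝ E) → TangentSpace I x}
    (he : Orthonormal ℝ e) :
    ∃ b : OrthonormalBasis (Fin (Module.finrank ℝ E)) ℝ (TangentSpace I x), ∀ i, b i = e i := by
  obtain ⟨b, hb⟩ := Orthonormal.exists_orthonormalBasis_extension_of_card_eq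
    (𝕜 := ℝ) (E := TangentSpace I x) (v := e) (s := Set.univ) (by simp [finrank_tangentSpace])
    (he.comp _ Subtype.val_injective)
  exact ⟨b, fun i ↦ hb i (Set.mem_univ i)⟩

theorem sum_inner_smul_eq {e : Fin (Module.finrank ℝ E) → TangentSpace I x}
    (he : Orthonormal ℝ e) (v : TangentSpace I x) : ∑ i, inner ℝ (e i) v • e i = v := by
  obtain ⟨b, hb⟩ := exists_orthonormalBasis_eq he
  simpa only [hb] using b.sum_repr' v

theorem IsGeodesicFrame.smoothAt {ι : Type*} {e : ι → Π x : M, TangentSpace I x}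
    (he : IsGeodesicFrame x e) (i : ι) : CMDiffAt ∞ (T% (e i)) x :=
  he.smooth.self_of_nhds i

theorem smooth_congr (hX : CMDiffAt ∞ (T% X) x) (h : ∀ᶠ y in 𝓝 x, X' y = X y) :
    CMDiffAt ∞ (T% X') x := by
  refine hX.congr_of_eventuallyEq ?_
  filter_upwards [h] with y hy
  rw [hy]

theorem inner_nabla_eq_koszul {x : M} (hX : MDiffAt (T% X) x) (hY : MDiffAt (T% Y) x)
    (hZ : MDiffAt (T% Z) x) : inner ℝ (nabla X Y x) (Z x) = koszul I X Y Z x :=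
  inner_leviCivitaAux_eq_koszul I hX hY hZ

theorem contMDiffAt_nabla (hX : CMDiffAt ∞ (T% X) x) (hY : CMDiffAt ∞ (T% Y) x) :
    CMDiffAt ∞ (T% (nabla X Y)) x := by
  obtain ⟨e, he⟩ := exists_isGeodesicFrame (I := I) x
  have h : CMDiffAt ∞ (T% (∑ i, koszul I X Y (e i) • e i)) x :=
    contMDiffAt_sum _ fun i _ ↦ (contMDiffAt_koszul hX hY (he.smoothAt i)).smul_section
      (he.smoothAt i)
  refine smooth_congr h ?_
  filter_upwards [he.smooth, he.orthonormal, eventually_mdifferentiableAt hX,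
    eventually_mdifferentiableAt hY] with y h1 h2 h3 h4
  rw [Finset.sum_apply, ← sum_inner_smul_eq h2 (nabla X Y y)]
  refine Finset.sum_congr rfl fun i _ ↦ ?_
  rw [real_inner_comm, inner_nabla_eq_koszul h3 h4 (mdifferentiableAt_of_smooth (h1 i))]
  rfl

theorem mlieBracket_mlieBracket_smul (hY : CMDiffAt ∞ (T% Y) x)
    (hZ : CMDiffAt ∞ (T% Z) x) (hf : CMDiffAt ∞ f x) :
    mlieBracket I X (mlieBracket I Y (f • Z)) x =
      dirDeriv X (dirDeriv Y f) x • Z x + dirDeriv Y f x • mlieBracket I X Z x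
        + dirDeriv X f x • mlieBracket I Y Z x + f x • mlieBracket I X (mlieBracket I Y Z) x := by
  have h : mlieBracket I Y (f • Z) =ᶠ[𝓝 x] dirDeriv Y f • Z + f • mlieBracket I Y Z := by
    filter_upwards [eventually_mdifferentiableAt hZ, eventually_mdifferentiableAt_fun hf]
      with y h1 h2
    exact mlieBracket_smul_right h2 h1
  have mf := mdifferentiableAt_of_smooth hf
  have mYf := mdifferentiableAt_of_smooth (contMDiffAt_dirDeriv hY hf)
  have mZ := mdifferentiableAt_of_smooth hZ
  have mYZ := mdifferentiableAt_of_smooth (contMDiffAt_mlieBracket hY hZ)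
  rw [EventuallyEq.mlieBracket_vectorField_eq (EventuallyEq.refl _ X) h,
    mlieBracket_add_right (mYf.smul_section mZ) (mf.smul_section mYZ),
    mlieBracket_smul_right mYf mZ, mlieBracket_smul_right mf mYZ]
  simp only [dirDeriv]
  abel

/-- The Lie bracket acts on functions as the commutator of the directional derivatives. -/
theorem dirDeriv_mlieBracket (hX : CMDiffAt ∞ (T% X) x) (hY : CMDiffAt ∞ (T% Y) x)
    (hf : CMDiffAt ∞ f x) :
    dirDeriv (mlieBracket I X Y) f x =
      dirDeriv X (dirDeriv Y f) x - dirDeriv Y (dirDeriv X f) x := by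
  rcases subsingleton_or_nontrivial (TangentSpace I x) with hs | hn
  · simp [dirDeriv, Subsingleton.elim _ (0 : TangentSpace I x)]
  obtain ⟨v, hv⟩ := exists_ne (0 : TangentSpace I x)
  let Z : Π x : M, TangentSpace I x := FiberBundle.extend E v
  have hZ : CMDiffAt ∞ (T% Z) x := (eventually_contMDiffAt_extend v).self_of_nhds
  have hZv : Z x = v := FiberBundle.extend_apply_self (F := E) v
  have h := mlieBracket_leibniz hX hY (hf.smul_section hZ)
  have h0 := mlieBracket_leibniz hX hY hZ
  rw [mlieBracket_mlieBracket_smul hY hZ hf, mlieBracket_mlieBracket_smul hX hZ hf,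
    mlieBracket_smul_right (mdifferentiableAt_of_smooth hf) (mdifferentiableAt_of_smooth hZ),
    h0, hZv] at h
  have h2 : (dirDeriv X (dirDeriv Y f) x - dirDeriv Y (dirDeriv X f) x
      - dirDeriv (mlieBracket I X Y) f x) • v = 0 := by
    rw [← sub_eq_zero] at h
    rw [← h]
    simp only [dirDeriv]
    module
  have h3 := (smul_eq_zero.1 h2).resolve_right hv
  linarith

theorem curvature_eq : curvature I X Y Z x =
    nabla X (nabla Y Z) x - nabla Y (nabla X Z) x - nabla (mlieBracket I X Y) Z x := rfl

theorem contMDiffAt_curvature (hX : CMDiffAt ∞ (T% X) x) (hY : CMDiffAt ∞ (T% Y) x)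
    (hZ : CMDiffAt ∞ (T% Z) x) : CMDiffAt ∞ (T% (curvature I X Y Z)) x :=
  ((contMDiffAt_nabla hX (contMDiffAt_nabla hY hZ)).sub_section
    (contMDiffAt_nabla hY (contMDiffAt_nabla hX hZ))).sub_section
    (contMDiffAt_nabla (contMDiffAt_mlieBracket hX hY) hZ)

theorem curvature_swap : curvature I X Y Z x = -curvature I Y X Z x := by
  rw [curvature_eq, curvature_eq, mlieBracket_swap, nabla_vec_neg, Pi.neg_apply]
  abel

theorem curvature_add_left (hX : CMDiffAt ∞ (T% X) x) (hX' : CMDiffAt ∞ (T% X') x)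
    (hZ : CMDiffAt ∞ (T% Z) x) :
    curvature I (X + X') Y Z x = curvature I X Y Z x + curvature I X' Y Z x := by
  have mX := mdifferentiableAt_of_smooth hX
  have mX' := mdifferentiableAt_of_smooth hX'
  have h1 : nabla (mlieBracket I (X + X') Y) Z x =
      nabla (mlieBracket I X Y) Z x + nabla (mlieBracket I X' Y) Z x := by
    simp [nabla, mlieBracket_add_left mX mX']
  rw [curvature_eq, curvature_eq, curvature_eq, h1, nabla_vec_add, nabla_vec_add,
    nabla_add (mdifferentiableAt_of_smooth (contMDiffAt_nabla hX hZ))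
      (mdifferentiableAt_of_smooth (contMDiffAt_nabla hX' hZ)), Pi.add_apply]
  abel

theorem curvature_smul_left (hf : CMDiffAt ∞ f x) (hX : CMDiffAt ∞ (T% X) x)
    (hZ : CMDiffAt ∞ (T% Z) x) :
    curvature I (f • X) Y Z x = f x • curvature I X Y Z x := by
  have mX := mdifferentiableAt_of_smooth hX
  have mf := mdifferentiableAt_of_smooth hf
  have h1 : nabla (mlieBracket I (f • X) Y) Z x =
      -(dirDeriv Y f x) • nabla X Z x + f x • nabla (mlieBracket I X Y) Z x := by
    simp [nabla, dirDeriv, mlieBracket_smul_left mf mX]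
  rw [curvature_eq, curvature_eq, h1, nabla_vec_smul, nabla_vec_smul,
    nabla_smul mf (mdifferentiableAt_of_smooth (contMDiffAt_nabla hX hZ)), Pi.smul_apply']
  module

theorem nabla_nabla_add (hY : CMDiffAt ∞ (T% Y) x) (hZ : CMDiffAt ∞ (T% Z) x)
    (hZ' : CMDiffAt ∞ (T% Z') x) :
    nabla X (nabla Y (Z + Z')) x = nabla X (nabla Y Z) x + nabla X (nabla Y Z') x := by
  have m1 := mdifferentiableAt_of_smooth (contMDiffAt_nabla hY hZ)
  have m2 := mdifferentiableAt_of_smooth (contMDiffAt_nabla hY hZ')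
  rw [nabla_congr (Y' := nabla Y Z + nabla Y Z') (mdifferentiableAt_of_smooth
    (contMDiffAt_nabla hY (hZ.add_section hZ'))) (mdifferentiableAt_add_section m1 m2),
    nabla_add m1 m2]
  filter_upwards [eventually_mdifferentiableAt hZ, eventually_mdifferentiableAt hZ'] with y h1 h2
  exact nabla_add h1 h2

theorem nabla_nabla_smul (hY : CMDiffAt ∞ (T% Y) x) (hf : CMDiffAt ∞ f x)
    (hZ : CMDiffAt ∞ (T% Z) x) :
    nabla X (nabla Y (f • Z)) x = f x • nabla X (nabla Y Z) x + dirDeriv X f x • nabla Y Z x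
      + dirDeriv Y f x • nabla X Z x + dirDeriv X (dirDeriv Y f) x • Z x := by
  have mf := mdifferentiableAt_of_smooth hf
  have mYf := mdifferentiableAt_of_smooth (contMDiffAt_dirDeriv hY hf)
  have mZ := mdifferentiableAt_of_smooth hZ
  have mYZ := mdifferentiableAt_of_smooth (contMDiffAt_nabla hY hZ)
  have m1 := mf.smul_section mYZ
  have m2 := mYf.smul_section mZ
  rw [nabla_congr (Y' := f • nabla Y Z + dirDeriv Y f • Z) (mdifferentiableAt_of_smooth
    (contMDiffAt_nabla hY (hf.smul_section hZ))) (mdifferentiableAt_add_section m1 m2),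
    nabla_add m1 m2, nabla_smul mf mYZ, nabla_smul mYf mZ]
  · abel
  · filter_upwards [eventually_mdifferentiableAt hZ, eventually_mdifferentiableAt_fun hf]
      with y h1 h2
    exact nabla_smul h2 h1

theorem curvature_add_right (hX : CMDiffAt ∞ (T% X) x) (hY : CMDiffAt ∞ (T% Y) x)
    (hZ : CMDiffAt ∞ (T% Z) x) (hZ' : CMDiffAt ∞ (T% Z') x) :
    curvature I X Y (Z + Z') x = curvature I X Y Z x + curvature I X Y Z' x := by
  rw [curvature_eq, curvature_eq, curvature_eq, nabla_nabla_add hY hZ hZ',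
    nabla_nabla_add hX hZ hZ', nabla_add (mdifferentiableAt_of_smooth hZ)
    (mdifferentiableAt_of_smooth hZ')]
  abel

theorem curvature_smul_right (hX : CMDiffAt ∞ (T% X) x) (hY : CMDiffAt ∞ (T% Y) x)
    (hf : CMDiffAt ∞ f x) (hZ : CMDiffAt ∞ (T% Z) x) :
    curvature I X Y (f • Z) x = f x • curvature I X Y Z x := by
  rw [curvature_eq, curvature_eq, nabla_nabla_smul hY hf hZ, nabla_nabla_smul hX hf hZ,
    nabla_smul (mdifferentiableAt_of_smooth hf) (mdifferentiableAt_of_smooth hZ),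
    dirDeriv_mlieBracket hX hY hf]
  module

theorem dirDeriv_dirDeriv_inner (hY : CMDiffAt ∞ (T% Y) x) (hZ : CMDiffAt ∞ (T% Z) x)
    (hW : CMDiffAt ∞ (T% W) x) :
    dirDeriv X (dirDeriv Y fun y ↦ inner ℝ (Z y) (W y)) x =
      inner ℝ (nabla X (nabla Y Z) x) (W x) + inner ℝ (nabla Y Z x) (nabla X W x)
        + (inner ℝ (nabla X Z x) (nabla Y W x) + inner ℝ (Z x) (nabla X (nabla Y W) x)) := by
  have mZ := mdifferentiableAt_of_smooth hZ
  have mW := mdifferentiableAt_of_smooth hW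
  have mYZ := mdifferentiableAt_of_smooth (contMDiffAt_nabla hY hZ)
  have mYW := mdifferentiableAt_of_smooth (contMDiffAt_nabla hY hW)
  rw [dirDeriv_congr
    (g := fun y ↦ inner ℝ (nabla Y Z y) (W y) + inner ℝ (Z y) (nabla Y W y)),
    dirDeriv_add (mdifferentiableAt_inner I mYZ mW) (mdifferentiableAt_inner I mZ mYW),
    dirDeriv_inner mYZ mW, dirDeriv_inner mZ mYW]
  filter_upwards [eventually_mdifferentiableAt hZ, eventually_mdifferentiableAt hW] with y h1 h2
  exact dirDeriv_inner h1 h2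

theorem inner_curvature_skew (hX : CMDiffAt ∞ (T% X) x) (hY : CMDiffAt ∞ (T% Y) x)
    (hZ : CMDiffAt ∞ (T% Z) x) (hW : CMDiffAt ∞ (T% W) x) :
    inner ℝ (curvature I X Y Z x) (W x) = -inner ℝ (curvature I X Y W x) (Z x) := by
  have h := dirDeriv_mlieBracket hX hY (contMDiffAt_inner hZ hW)
  rw [dirDeriv_dirDeriv_inner hY hZ hW, dirDeriv_dirDeriv_inner hX hZ hW,
    dirDeriv_inner (mdifferentiableAt_of_smooth hZ) (mdifferentiableAt_of_smooth hW)] at h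
  rw [curvature_eq, curvature_eq, real_inner_comm (Z x)]
  simp only [inner_sub_left, inner_sub_right]
  linarith

theorem nabla_nabla_sub (hX : CMDiffAt ∞ (T% X) x) (hY : CMDiffAt ∞ (T% Y) x) :
    nabla Z (nabla X Y) x - nabla Z (nabla Y X) x = nabla Z (mlieBracket I X Y) x := by
  have m1 := mdifferentiableAt_of_smooth (contMDiffAt_nabla hX hY)
  have m2 := mdifferentiableAt_of_smooth (contMDiffAt_nabla hY hX)
  rw [← nabla_sub m1 m2]
  refine nabla_congr (mdifferentiableAt_sub_section m1 m2)
    (mdifferentiableAt_of_smooth (contMDiffAt_mlieBracket hX hY)) ?_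
  filter_upwards [eventually_mdifferentiableAt hX, eventually_mdifferentiableAt hY] with y h1 h2
  exact nabla_sub_nabla h1 h2

/-- The first Bianchi identity. -/
theorem curvature_cyclic (hX : CMDiffAt ∞ (T% X) x) (hY : CMDiffAt ∞ (T% Y) x)
    (hZ : CMDiffAt ∞ (T% Z) x) :
    curvature I X Y Z x + curvature I Y Z X x + curvature I Z X Y x = 0 := by
  have key : ∀ {X Y Z : Π x : M, TangentSpace I x}, CMDiffAt ∞ (T% X) x → CMDiffAt ∞ (T% Y) x →
      CMDiffAt ∞ (T% Z) x → nabla X (nabla Y Z) x - nabla X (nabla Z Y) x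
        - nabla (mlieBracket I Y Z) X x = mlieBracket I X (mlieBracket I Y Z) x := by
    intro X Y Z hX hY hZ
    rw [nabla_nabla_sub hY hZ, nabla_sub_nabla (mdifferentiableAt_of_smooth hX)
      (mdifferentiableAt_of_smooth (contMDiffAt_mlieBracket hY hZ))]
  have h1 := key hX hY hZ
  have h2 := key hY hZ hX
  have h3 := key hZ hX hY
  have hJ := mlieBracket_leibniz hX hY hZ
  have e1 : mlieBracket I Z (mlieBracket I X Y) x = -mlieBracket I (mlieBracket I X Y) Z x :=
    mlieBracket_swap_apply
  have e2 : mlieBracket I Y (mlieBracket I Z X) x = -mlieBracket I Y (mlieBracket I X Z) x := by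
    rw [mlieBracket_swap (V := Z) (W := X)]
    have := mlieBracket_const_smul_right (I := I) (V := Y) (c := (-1 : ℝ))
      (mdifferentiableAt_of_smooth (contMDiffAt_mlieBracket hX hZ))
    simpa using this
  rw [hJ] at h1
  rw [e1] at h3
  rw [e2] at h2
  calc curvature I X Y Z x + curvature I Y Z X x + curvature I Z X Y x
      = (nabla X (nabla Y Z) x - nabla X (nabla Z Y) x - nabla (mlieBracket I Y Z) X x)
        + (nabla Y (nabla Z X) x - nabla Y (nabla X Z) x - nabla (mlieBracket I Z X) Y x)
        + (nabla Z (nabla X Y) x - nabla Z (nabla Y X) x - nabla (mlieBracket I X Y) Z x) := by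
        rw [curvature_eq, curvature_eq, curvature_eq]
        abel
    _ = 0 := by
        rw [h1, h2, h3]
        abel

end Curvature

section Tensor

open VectorField

variable {X Y Z W : Π x : M, TangentSpace I x} {f g : M → ℝ} {x : M}

theorem tensorial_expand {A : Type*} [AddCommGroup A] [Module ℝ A]
    {Φ : (Π x : M, TangentSpace I x) → A}
    (hadd : ∀ {X X'}, CMDiffAt ∞ (T% X) x → CMDiffAt ∞ (T% X') x → Φ (X + X') = Φ X + Φ X')
    (hsmul : ∀ {f : M → ℝ} {X}, CMDiffAt ∞ f x → CMDiffAt ∞ (T% X) x → Φ (f • X) = f x • Φ X)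
    {e : Fin (Module.finrank ℝ E) → Π x : M, TangentSpace I x} (he : IsGeodesicFrame x e)
    (hX : CMDiffAt ∞ (T% X) x) : Φ X = ∑ i, inner ℝ (e i x) (X x) • Φ (e i) := by
  classical
  let c (i) (y : M) : ℝ := inner ℝ (e i y) (X y)
  have hc (i) : CMDiffAt ∞ (c i) x := contMDiffAt_inner (he.smoothAt i) hX
  have hce (i) : CMDiffAt ∞ (T% (c i • e i)) x := (hc i).smul_section (he.smoothAt i)
  have h0 : Φ 0 = 0 := by
    have h : CMDiffAt ∞ (T% (0 : Π x : M, TangentSpace I x)) x := by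
      simpa using! contMDiffAt_sum (x := x) (∅ : Finset (Fin 0)) (Y := fun _ ↦ 0) (by simp)
    simpa using hsmul (f := fun _ ↦ 0) contMDiffAt_const h
  have hsum (s : Finset (Fin (Module.finrank ℝ E))) :
      Φ (∑ i ∈ s, c i • e i) = ∑ i ∈ s, c i x • Φ (e i) := by
    induction s using Finset.induction_on with
    | empty => simpa using h0
    | insert a s ha ih =>
      rw [Finset.sum_insert ha, Finset.sum_insert ha, hadd (hce a)
        (contMDiffAt_sum _ fun i _ ↦ hce i), ih, hsmul (hc a) (he.smoothAt a)]
  rw [← hsum]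
  let ψ (y : M) : ℝ := if X y = (∑ i, c i • e i) y then 1 else 0
  have hev : ∀ᶠ y in 𝓝 x, X y = (∑ i, c i • e i) y := by
    filter_upwards [he.orthonormal] with y hy
    rw [Finset.sum_apply]
    exact (sum_inner_smul_eq hy (X y)).symm
  have hψ : CMDiffAt ∞ ψ x :=
    (contMDiffAt_const (c := (1 : ℝ))).congr_of_eventuallyEq (hev.mono fun y hy ↦ if_pos hy)
  have hψx : ψ x = 1 := if_pos hev.self_of_nhds
  have hψX : ψ • X = ψ • ∑ i, c i • e i := by
    ext1 y
    by_cases h : X y = (∑ i, c i • e i) y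
    · simp only [Pi.smul_apply', h]
    · have : ψ y = 0 := if_neg h
      simp only [Pi.smul_apply', this, zero_smul]
  have h1 := hsmul hψ hX
  have h2 := hsmul hψ (contMDiffAt_sum _ fun i _ ↦ hce i : CMDiffAt ∞ (T% (∑ i, c i • e i)) x)
  rw [hψx, one_smul] at h1 h2
  rw [← h1, hψX, h2]

theorem curvature_expand {e : Fin (Module.finrank ℝ E) → Π x : M, TangentSpace I x}
    (he : IsGeodesicFrame x e) (hX : CMDiffAt ∞ (T% X) x) (hY : CMDiffAt ∞ (T% Y) x)
    (hZ : CMDiffAt ∞ (T% Z) x) :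
    curvature I X Y Z x = ∑ i, inner ℝ (e i x) (X x) • ∑ j, inner ℝ (e j x) (Y x) •
      ∑ k, inner ℝ (e k x) (Z x) • curvature I (e i) (e j) (e k) x := by
  rw [tensorial_expand (Φ := fun X ↦ curvature I X Y Z x)
    (fun h h' ↦ curvature_add_left h h' hZ) (fun hf h ↦ curvature_smul_left hf h hZ) he hX]
  refine Finset.sum_congr rfl fun i _ ↦ ?_
  congr 1
  rw [tensorial_expand (Φ := fun Y ↦ curvature I (e i) Y Z x) ?_ ?_ he hY]
  · refine Finset.sum_congr rfl fun j _ ↦ ?_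
    congr 1
    exact tensorial_expand (Φ := fun Z ↦ curvature I (e i) (e j) Z x)
      (fun h h' ↦ curvature_add_right (he.smoothAt i) (he.smoothAt j) h h')
      (fun hf h ↦ curvature_smul_right (he.smoothAt i) (he.smoothAt j) hf h) he hZ
  · intro Y Y' h h'
    simp only [curvature_swap (X := e i)]
    rw [curvature_add_left h h' hZ, neg_add]
  · intro f Y hf h
    simp only [curvature_swap (X := e i)]
    rw [curvature_smul_left hf h hZ, smul_neg]

theorem smoothAt_extend (v : TangentSpace I x) :
    CMDiffAt ∞ (T% (FiberBundle.extend E v : Π x : M, TangentSpace I x)) x :=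
  (eventually_contMDiffAt_extend v).self_of_nhds

theorem riemann_eq_curvature (hX : CMDiffAt ∞ (T% X) x) (hY : CMDiffAt ∞ (T% Y) x)
    (hZ : CMDiffAt ∞ (T% Z) x) : riemann I x (X x) (Y x) (Z x) = curvature I X Y Z x := by
  obtain ⟨e, he⟩ := exists_isGeodesicFrame (I := I) x
  rw [riemann, curvature_expand he hX hY hZ,
    curvature_expand he (smoothAt_extend _) (smoothAt_extend _) (smoothAt_extend _)]
  simp only [FiberBundle.extend_apply_self (F := E)]

theorem riemann_add_left (u u' v w : TangentSpace I x) :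
    riemann I x (u + u') v w = riemann I x u v w + riemann I x u' v w := by
  have h := riemann_eq_curvature ((smoothAt_extend u).add_section (smoothAt_extend u'))
    (smoothAt_extend v) (smoothAt_extend w)
  rw [curvature_add_left (smoothAt_extend u) (smoothAt_extend u') (smoothAt_extend w)] at h
  simpa only [Pi.add_apply, FiberBundle.extend_apply_self (F := E), riemann] using h

theorem riemann_smul_left (c : ℝ) (u v w : TangentSpace I x) :
    riemann I x (c • u) v w = c • riemann I x u v w := by
  have hc : CMDiffAt ∞ (fun _ : M ↦ c) x := contMDiffAt_const
  have h := riemann_eq_curvature (hc.smul_section (smoothAt_extend u))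
    (smoothAt_extend v) (smoothAt_extend w)
  rw [curvature_smul_left hc (smoothAt_extend u) (smoothAt_extend w)] at h
  simpa only [Pi.smul_apply', FiberBundle.extend_apply_self (F := E), riemann] using h

theorem riemann_swap (u v w : TangentSpace I x) : riemann I x u v w = -riemann I x v u w :=
  curvature_swap

theorem riemann_add_mid (u v v' w : TangentSpace I x) :
    riemann I x u (v + v') w = riemann I x u v w + riemann I x u v' w := by
  simp only [riemann_swap u]
  rw [riemann_add_left, neg_add]

theorem riemann_smul_mid (c : ℝ) (u v w : TangentSpace I x) :
    riemann I x u (c • v) w = c • riemann I x u v w := by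
  simp only [riemann_swap u]
  rw [riemann_smul_left, smul_neg]

theorem riemann_add_right (u v w w' : TangentSpace I x) :
    riemann I x u v (w + w') = riemann I x u v w + riemann I x u v w' := by
  have h := riemann_eq_curvature (smoothAt_extend u) (smoothAt_extend v)
    ((smoothAt_extend w).add_section (smoothAt_extend w'))
  rw [curvature_add_right (smoothAt_extend u) (smoothAt_extend v) (smoothAt_extend w)
    (smoothAt_extend w')] at h
  simpa only [Pi.add_apply, FiberBundle.extend_apply_self (F := E), riemann] using h

theorem riemann_smul_right (c : ℝ) (u v w : TangentSpace I x) :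
    riemann I x u v (c • w) = c • riemann I x u v w := by
  have hc : CMDiffAt ∞ (fun _ : M ↦ c) x := contMDiffAt_const
  have h := riemann_eq_curvature (smoothAt_extend u)
    (smoothAt_extend v) (hc.smul_section (smoothAt_extend w))
  rw [curvature_smul_right (smoothAt_extend u) (smoothAt_extend v) hc (smoothAt_extend w)] at h
  simpa only [Pi.smul_apply', FiberBundle.extend_apply_self (F := E), riemann] using h

theorem inner_riemann_skew (u v w z : TangentSpace I x) :
    inner ℝ (riemann I x u v w) z = -inner ℝ (riemann I x u v z) w := by
  have h := inner_curvature_skew (smoothAt_extend u) (smoothAt_extend v) (smoothAt_extend w)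
    (smoothAt_extend z)
  simpa only [FiberBundle.extend_apply_self (F := E), riemann] using h

theorem riemann_cyclic (u v w : TangentSpace I x) :
    riemann I x u v w + riemann I x v w u + riemann I x w u v = 0 :=
  curvature_cyclic (smoothAt_extend u) (smoothAt_extend v) (smoothAt_extend w)

/-- The trace of a bilinear form does not depend on the orthonormal basis. -/
theorem sum_bilin_orthonormalBasis {V ι ι' : Type*} [NormedAddCommGroup V]
    [InnerProductSpace ℝ V] [Fintype ι] [Fintype ι'] (b : OrthonormalBasis ι ℝ V)
    (b' : OrthonormalBasis ι' ℝ V) (B : V →ₗ[ℝ] V →ₗ[ℝ] ℝ) :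
    ∑ i, B (b i) (b i) = ∑ j, B (b' j) (b' j) := by
  have h1 (i) : B (b i) (b i) = ∑ j, inner ℝ (b' j) (b i) * B (b' j) (b i) := by
    have h := congrArg (fun v ↦ B v (b i)) (b'.sum_repr' (b i))
    simpa using h.symm
  have h2 (j) : B (b' j) (b' j) = ∑ i, inner ℝ (b i) (b' j) * B (b' j) (b i) := by
    have h := congrArg (fun v ↦ B (b' j) v) (b.sum_repr' (b' j))
    simpa using h.symm
  simp_rw [h1, h2]
  rw [Finset.sum_comm]
  simp_rw [real_inner_comm]

/-- The Ricci tensor as a bilinear form. -/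
def ricciBilin (I : ModelWithCorners ℝ E H) {M : Type*} [TopologicalSpace M] [ChartedSpace H M]
    [IsManifold I ∞ M] [RiemannianBundle (fun x : M ↦ TangentSpace I x)]
    [IsContMDiffRiemannianBundle I ∞ E (fun x : M ↦ TangentSpace I x)] (x : M) :
    TangentSpace I x →ₗ[ℝ] TangentSpace I x →ₗ[ℝ] ℝ :=
  LinearMap.mk₂ ℝ (ricci I x)
    (fun v v' w ↦ by simp [ricci, riemann_add_mid, inner_add_left, Finset.sum_add_distrib])
    (fun c v w ↦ by simp [ricci, riemann_smul_mid, inner_smul_left, Finset.mul_sum])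
    (fun v w w' ↦ by simp [ricci, riemann_add_right, inner_add_left, Finset.sum_add_distrib])
    (fun c v w ↦ by simp [ricci, riemann_smul_right, inner_smul_left, Finset.mul_sum])

theorem ricciBilin_apply (v w : TangentSpace I x) : ricciBilin I x v w = ricci I x v w := rfl

section Traces

variable {ι : Type*} [Fintype ι] (b : OrthonormalBasis ι ℝ (TangentSpace I x))

theorem ricci_eq_sum (v w : TangentSpace I x) :
    ricci I x v w = ∑ i, inner ℝ (riemann I x (b i) v w) (b i) :=
  sum_bilin_orthonormalBasis (stdOrthonormalBasis ℝ (TangentSpace I x)) b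
    (LinearMap.mk₂ ℝ (fun u u' ↦ inner ℝ (riemann I x u v w) u')
      (fun u u' z ↦ by rw [riemann_add_left, inner_add_left])
      (fun c u z ↦ by rw [riemann_smul_left, real_inner_smul_left]; rfl)
      (fun u z z' ↦ by rw [inner_add_right])
      (fun c u z ↦ by rw [real_inner_smul_right]; rfl))

theorem scalarCurvature_eq_sum : scalarCurvature I x = ∑ i, ricci I x (b i) (b i) :=
  sum_bilin_orthonormalBasis (stdOrthonormalBasis ℝ (TangentSpace I x)) b (ricciBilin I x)

theorem ricciNormSq_eq_sum : ricciNormSq I x = ∑ i, ∑ j, ricci I x (b i) (b j) ^ 2 := by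
  have h (v : TangentSpace I x) :
      ∑ j, ricci I x v (stdOrthonormalBasis ℝ (TangentSpace I x) j) ^ 2
        = ∑ j, ricci I x v (b j) ^ 2 := by
    have := sum_bilin_orthonormalBasis (stdOrthonormalBasis ℝ (TangentSpace I x)) b
      (LinearMap.mk₂ ℝ (fun w w' ↦ ricciBilin I x v w * ricciBilin I x v w')
        (fun w w' z ↦ by rw [map_add, add_mul])
        (fun c w z ↦ by rw [map_smul, smul_eq_mul, smul_eq_mul, mul_assoc])
        (fun w z z' ↦ by rw [map_add, mul_add])
        (fun c w z ↦ by rw [map_smul, smul_eq_mul, smul_eq_mul, mul_left_comm]))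
    simpa [LinearMap.mk₂_apply, ricciBilin_apply, ← sq] using this
  simp only [ricciNormSq, h]
  rw [Finset.sum_comm]
  conv_rhs => rw [Finset.sum_comm]
  refine Finset.sum_congr rfl fun j _ ↦ ?_
  have := sum_bilin_orthonormalBasis (stdOrthonormalBasis ℝ (TangentSpace I x)) b
    (LinearMap.mk₂ ℝ (fun w w' ↦ ricciBilin I x w (b j) * ricciBilin I x w' (b j))
      (fun w w' z ↦ by rw [map_add, LinearMap.add_apply, add_mul])
      (fun c w z ↦ by rw [map_smul, LinearMap.smul_apply, smul_eq_mul, smul_eq_mul, mul_assoc])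
      (fun w z z' ↦ by rw [map_add, LinearMap.add_apply, mul_add])
      (fun c w z ↦ by
        rw [map_smul, LinearMap.smul_apply, smul_eq_mul, smul_eq_mul, mul_left_comm]))
  simpa [LinearMap.mk₂_apply, ricciBilin_apply, ← sq] using this

theorem laplacian_eq_sum : laplacian I f x = ∑ i, hessian I f x (b i) (b i) :=
  sum_bilin_orthonormalBasis (stdOrthonormalBasis ℝ (TangentSpace I x)) b
    (LinearMap.mk₂ ℝ (hessian I f x)
      (fun u u' z ↦ by simp [hessian, inner_add_left])
      (fun c u z ↦ by simp [hessian, inner_smul_left])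
      (fun u z z' ↦ by simp [hessian, inner_add_right])
      (fun c u z ↦ by simp [hessian, inner_smul_right]))

end Traces

theorem ricci_symm (v w : TangentSpace I x) : ricci I x v w = ricci I x w v := by
  let b := stdOrthonormalBasis ℝ (TangentSpace I x)
  have h (i) : inner ℝ (riemann I x (b i) v w) (b i) = inner ℝ (riemann I x (b i) w v) (b i) := by
    have h1 := congrArg (fun z ↦ inner ℝ z (b i)) (riemann_cyclic (b i) v w)
    have h2 : (inner ℝ (riemann I x v w (b i)) (b i) : ℝ) = 0 := by
      linarith [inner_riemann_skew v w (b i) (b i)]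
    simp only [inner_add_left, inner_zero_left, h2, riemann_swap w, inner_neg_left] at h1
    linarith
  rw [ricci_eq_sum b, ricci_eq_sum b]
  exact Finset.sum_congr rfl fun i _ ↦ h i

end Tensor

section ContractedBianchi

open VectorField

variable {X Y Z W : Π x : M, TangentSpace I x} {f g : M → ℝ} {x : M}

theorem mlieBracket_eq_zero_of_parallel (hX : CMDiffAt ∞ (T% X) x) (hY : CMDiffAt ∞ (T% Y) x)
    (hX' : ∀ V : Π x : M, TangentSpace I x, nabla V X x = 0)
    (hY' : ∀ V : Π x : M, TangentSpace I x, nabla V Y x = 0) : mlieBracket I X Y x = 0 := by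
  rw [← nabla_sub_nabla (mdifferentiableAt_of_smooth hX) (mdifferentiableAt_of_smooth hY),
    hX', hY', sub_zero]

/-- The second Bianchi identity, for fields that are parallel at the point. -/
theorem nabla_curvature_cyclic (hX : CMDiffAt ∞ (T% X) x) (hY : CMDiffAt ∞ (T% Y) x)
    (hZ : CMDiffAt ∞ (T% Z) x) (hW : CMDiffAt ∞ (T% W) x)
    (hX' : ∀ V : Π x : M, TangentSpace I x, nabla V X x = 0)
    (hY' : ∀ V : Π x : M, TangentSpace I x, nabla V Y x = 0)
    (hZ' : ∀ V : Π x : M, TangentSpace I x, nabla V Z x = 0)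
    (hW' : ∀ V : Π x : M, TangentSpace I x, nabla V W x = 0) :
    nabla X (curvature I Y Z W) x + nabla Y (curvature I Z X W) x
      + nabla Z (curvature I X Y W) x = 0 := by
  have key : ∀ {X Y Z : Π x : M, TangentSpace I x}, CMDiffAt ∞ (T% X) x → CMDiffAt ∞ (T% Y) x →
      CMDiffAt ∞ (T% Z) x → (∀ V : Π x : M, TangentSpace I x, nabla V Y x = 0) →
      (∀ V : Π x : M, TangentSpace I x, nabla V Z x = 0) →
      nabla X (curvature I Y Z W) x =
          nabla X (nabla Y (nabla Z W)) x - nabla X (nabla Z (nabla Y W)) x ∧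
        nabla Y (nabla Z (nabla X W)) x = nabla Z (nabla Y (nabla X W)) x := by
    intro X Y Z hX hY hZ hY' hZ'
    have hb := contMDiffAt_mlieBracket hY hZ
    have hb0 := mlieBracket_eq_zero_of_parallel hY hZ hY' hZ'
    have m1 := mdifferentiableAt_of_smooth (contMDiffAt_nabla hY (contMDiffAt_nabla hZ hW))
    have m2 := mdifferentiableAt_of_smooth (contMDiffAt_nabla hZ (contMDiffAt_nabla hY hW))
    have m3 := mdifferentiableAt_of_smooth (contMDiffAt_nabla hb hW)
    constructor
    · have h1 : curvature I Y Z W = nabla Y (nabla Z W) - nabla Z (nabla Y W)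
          - nabla (mlieBracket I Y Z) W := rfl
      have h2 := riemann_eq_curvature hb hX hW
      rw [hb0, ← zero_smul ℝ (0 : TangentSpace I x), riemann_smul_left, zero_smul, curvature_eq,
        nabla_vec_eq_zero hb0, hW', sub_zero, zero_sub, eq_comm, neg_eq_zero] at h2
      rw [h1, nabla_sub (mdifferentiableAt_sub_section m1 m2) m3, nabla_sub m1 m2, h2, sub_zero]
    · have h2 := riemann_eq_curvature hY hZ (contMDiffAt_nabla hX hW)
      rw [hW', ← zero_smul ℝ (0 : TangentSpace I x), riemann_smul_right, zero_smul, curvature_eq,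
        nabla_vec_eq_zero (Y := nabla X W) hb0, sub_zero, eq_comm, sub_eq_zero] at h2
      exact h2
  obtain ⟨a1, b1⟩ := key hX hY hZ hY' hZ'
  obtain ⟨a2, b2⟩ := key hY hZ hX hZ' hX'
  obtain ⟨a3, b3⟩ := key hZ hX hY hX' hY'
  rw [a1, a2, a3, b1, b2, b3]
  abel

theorem dirDeriv_neg : dirDeriv X (fun y ↦ -f y) x = -dirDeriv X f x := by
  simp [dirDeriv, mvfderiv_fun_neg]

theorem dirDeriv_const_mul (c : ℝ) (hf : MDiffAt f x) :
    dirDeriv X (fun y ↦ c * f y) x = c * dirDeriv X f x := by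
  rw [dirDeriv_mul mdifferentiableAt_const hf, dirDeriv_const]
  ring

theorem mdifferentiableAt_const_add_mul (a c : ℝ) (hf : MDiffAt f x) :
    MDiffAt (fun y ↦ a + c * f y) x :=
  mdifferentiableAt_const.add (mdifferentiableAt_const.mul hf)

theorem dirDeriv_const_add_mul (a c : ℝ) (hf : MDiffAt f x) :
    dirDeriv X (fun y ↦ a + c * f y) x = c * dirDeriv X f x := by
  rw [dirDeriv_add (g := fun y ↦ c * f y) mdifferentiableAt_const
    (mdifferentiableAt_const.mul hf), dirDeriv_const, zero_add]
  exact dirDeriv_const_mul c hf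

variable {e : Fin (Module.finrank ℝ E) → Π x : M, TangentSpace I x}

namespace IsGeodesicFrame

theorem eventually_basis (he : IsGeodesicFrame x e) : ∀ᶠ y in 𝓝 x,
    (∀ i, CMDiffAt ∞ (T% (e i)) y) ∧
    ∃ b : OrthonormalBasis (Fin (Module.finrank ℝ E)) ℝ (TangentSpace I y), ∀ i, b i = e i y := by
  filter_upwards [he.smooth, he.orthonormal] with y h1 h2
  exact ⟨h1, exists_orthonormalBasis_eq h2⟩

theorem mdifferentiableAt (he : IsGeodesicFrame x e) (i) : MDiffAt (T% (e i)) x :=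
  mdifferentiableAt_of_smooth (he.smoothAt i)

theorem dirDeriv_inner_left (he : IsGeodesicFrame x e) (i) (hX : MDiffAt (T% X) x) :
    dirDeriv Y (fun y ↦ inner ℝ (X y) (e i y)) x = inner ℝ (nabla Y X x) (e i x) := by
  rw [dirDeriv_inner hX (he.mdifferentiableAt i), he.parallel, inner_zero_right, add_zero]

theorem inner_eq (he : IsGeodesicFrame x e) (i j) :
    inner ℝ (e i x) (e j x) = if i = j then (1 : ℝ) else 0 :=
  orthonormal_iff_ite.1 he.orthonormal.self_of_nhds i j

theorem ricci_eventuallyEq (he : IsGeodesicFrame x e) (k i) :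
    (fun y ↦ ricci I y (e k y) (e i y)) =ᶠ[𝓝 x]
      fun y ↦ ∑ j, inner ℝ (curvature I (e j) (e k) (e i) y) (e j y) := by
  filter_upwards [he.eventually_basis] with y ⟨h1, b, hb⟩
  rw [ricci_eq_sum b]
  refine Finset.sum_congr rfl fun j _ ↦ ?_
  rw [hb, riemann_eq_curvature (h1 j) (h1 k) (h1 i)]

theorem scalarCurvature_eventuallyEq (he : IsGeodesicFrame x e) :
    (scalarCurvature I : M → ℝ) =ᶠ[𝓝 x] fun y ↦ ∑ j, ricci I y (e j y) (e j y) := by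
  filter_upwards [he.eventually_basis] with y ⟨_, b, hb⟩
  rw [scalarCurvature_eq_sum b]
  simp only [hb]

theorem contMDiffAt_inner_curvature (he : IsGeodesicFrame x e) (i j k l) :
    CMDiffAt ∞ (fun y ↦ (inner ℝ (curvature I (e i) (e j) (e k) y) (e l y) : ℝ)) x :=
  contMDiffAt_inner (contMDiffAt_curvature (he.smoothAt i) (he.smoothAt j) (he.smoothAt k))
    (he.smoothAt l)

theorem contMDiffAt_ricci (he : IsGeodesicFrame x e) (k i) :
    CMDiffAt ∞ (fun y ↦ ricci I y (e k y) (e i y)) x := by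
  refine ContMDiffAt.congr_of_eventuallyEq ?_ (he.ricci_eventuallyEq k i)
  exact contMDiffAt_finsetSum fun j _ ↦ he.contMDiffAt_inner_curvature j k i j

end IsGeodesicFrame

theorem contMDiffAt_scalarCurvature (x : M) : CMDiffAt ∞ (scalarCurvature I : M → ℝ) x := by
  obtain ⟨e, he⟩ := exists_isGeodesicFrame (I := I) x
  refine ContMDiffAt.congr_of_eventuallyEq ?_ he.scalarCurvature_eventuallyEq
  exact contMDiffAt_finsetSum fun j _ ↦ he.contMDiffAt_ricci j j

theorem inner_grad (v : TangentSpace I x) : inner ℝ (grad I f x) v = mvfderiv I f x v :=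
  InnerProductSpace.toDual_symm_apply

theorem contMDiffAt_grad (hf : CMDiffAt ∞ f x) : CMDiffAt ∞ (T% (grad I f)) x := by
  obtain ⟨e, he⟩ := exists_isGeodesicFrame (I := I) x
  have h : CMDiffAt ∞ (T% (∑ i, dirDeriv (e i) f • e i)) x :=
    contMDiffAt_sum _ fun i _ ↦ (contMDiffAt_dirDeriv (he.smoothAt i) hf).smul_section
      (he.smoothAt i)
  refine smooth_congr h ?_
  filter_upwards [he.orthonormal] with y h2
  rw [Finset.sum_apply, ← sum_inner_smul_eq h2 (grad I f y)]
  refine Finset.sum_congr rfl fun i _ ↦ ?_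
  rw [real_inner_comm, inner_grad]
  rfl

/-- The contracted second Bianchi identity `dR = 2 div Ric`. -/
theorem IsGeodesicFrame.dirDeriv_scalarCurvature (he : IsGeodesicFrame x e) (k) :
    dirDeriv (e k) (scalarCurvature I) x =
      2 * ∑ i, dirDeriv (e i) (fun y ↦ ricci I y (e k y) (e i y)) x := by
  let q (a b c d : Fin (Module.finrank ℝ E)) (y : M) : ℝ :=
    inner ℝ (curvature I (e a) (e b) (e c) y) (e d y)
  have mq (a b c d) : MDiffAt (q a b c d) x :=
    mdifferentiableAt_of_smooth (he.contMDiffAt_inner_curvature a b c d)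
  have hq (X : Π x : M, TangentSpace I x) (a b c d) :
      dirDeriv X (q a b c d) x = inner ℝ (nabla X (curvature I (e a) (e b) (e c)) x) (e d x) :=
    he.dirDeriv_inner_left d (mdifferentiableAt_of_smooth
      (contMDiffAt_curvature (he.smoothAt a) (he.smoothAt b) (he.smoothAt c)))
  have hric (X : Π x : M, TangentSpace I x) (a b) :
      dirDeriv X (fun y ↦ ricci I y (e a y) (e b y)) x = ∑ j, dirDeriv X (q j a b j) x := by
    rw [dirDeriv_congr (he.ricci_eventuallyEq a b)]
    exact (dirDeriv_sum _ fun j _ ↦ mq j a b j).2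
  have hS : dirDeriv (e k) (scalarCurvature I) x = ∑ j, ∑ i, dirDeriv (e k) (q i j j i) x := by
    rw [dirDeriv_congr he.scalarCurvature_eventuallyEq, (dirDeriv_sum _ fun j _ ↦
      mdifferentiableAt_of_smooth (he.contMDiffAt_ricci j j)).2]
    exact Finset.sum_congr rfl fun j _ ↦ hric _ j j
  have hskew (X : Π x : M, TangentSpace I x) (a b c d) :
      dirDeriv X (q a b c d) x = -dirDeriv X (q a b d c) x := by
    rw [← dirDeriv_neg]
    refine dirDeriv_congr ?_
    filter_upwards [he.smooth] with y hy
    exact inner_curvature_skew (hy a) (hy b) (hy c) (hy d)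
  have hswap (X : Π x : M, TangentSpace I x) (a b c d) :
      dirDeriv X (q a b c d) x = -dirDeriv X (q b a c d) x := by
    rw [← dirDeriv_neg]
    refine dirDeriv_congr (Eventually.of_forall fun y ↦ ?_)
    simp only [q]
    rw [curvature_swap, inner_neg_left]
  have hB (i j) : dirDeriv (e k) (q i j j i) x =
      dirDeriv (e i) (q j k i j) x + dirDeriv (e j) (q i k j i) x := by
    have h := nabla_curvature_cyclic (he.smoothAt k) (he.smoothAt i) (he.smoothAt j)
      (he.smoothAt j) (he.parallel k) (he.parallel i) (he.parallel j) (he.parallel j)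
    have h' := congrArg (fun v ↦ (inner ℝ v (e i x) : ℝ)) h
    simp only [inner_add_left, inner_zero_left, ← hq] at h'
    rw [hskew (e i), hswap (e j) k i] at h'
    linarith
  rw [hS]
  simp_rw [hB, hric, Finset.sum_add_distrib]
  rw [Finset.sum_comm]
  ring

end ContractedBianchi

section Soliton

variable {f : M → ℝ} {α β lam : ℝ}

namespace IsGradientRicciYamabeSoliton

theorem trace_eq (hf : IsGradientRicciYamabeSoliton I α β lam f) (x : M) :
    α * scalarCurvature I x + laplacian I f x
      + (lam - β / 2 * scalarCurvature I x) * Module.finrank ℝ E = 0 := by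
  let b := stdOrthonormalBasis ℝ (TangentSpace I x)
  have h : ∑ i, (α * ricci I x (b i) (b i) + hessian I f x (b i) (b i)
      + (lam - β / 2 * scalarCurvature I x) * inner ℝ (b i) (b i)) = 0 :=
    Finset.sum_eq_zero fun i _ ↦ hf.soliton_eq x (b i) (b i)
  simp only [Finset.sum_add_distrib, ← Finset.mul_sum] at h
  rw [← scalarCurvature_eq_sum b, ← laplacian_eq_sum b] at h
  have hb (i) : inner ℝ (b i) (b i) = (1 : ℝ) := by
    rw [real_inner_self_eq_norm_sq, b.orthonormal.1 i, one_pow]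
  simp only [hb, Finset.sum_const, Finset.card_univ, Fintype.card_fin, nsmul_eq_mul, mul_one] at h
  exact h

variable {x : M} {e : Fin (Module.finrank ℝ E) → Π x : M, TangentSpace I x}

theorem inner_nabla_grad (hf : IsGradientRicciYamabeSoliton I α β lam f)
    (X Y : Π x : M, TangentSpace I x) (y : M) : inner ℝ (nabla X (grad I f) y) (Y y) =
      -α * ricci I y (X y) (Y y) - (lam - β / 2 * scalarCurvature I y) * inner ℝ (X y) (Y y) := by
  have h := hf.soliton_eq y (X y) (Y y)
  have h' : hessian I f y (X y) (Y y) = inner ℝ (nabla X (grad I f) y) (Y y) := rfl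
  linarith

theorem gradient_frame (hf : IsGradientRicciYamabeSoliton I α β lam f)
    (he : IsGeodesicFrame x e) (k) :
    (α - β * ((Module.finrank ℝ E : ℝ) - 1)) * dirDeriv (e k) (scalarCurvature I) x =
      2 * ricci I x (grad I f x) (e k x) := by
  have hξ : CMDiffAt ∞ (T% (grad I f)) x := contMDiffAt_grad (hf.smooth x)
  have mS : MDiffAt (scalarCurvature I : M → ℝ) x :=
    mdifferentiableAt_of_smooth (contMDiffAt_scalarCurvature x)
  have mξ (i) : MDiffAt (T% (nabla (e i) (grad I f))) x :=
    mdifferentiableAt_of_smooth (contMDiffAt_nabla (he.smoothAt i) hξ)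
  have h1 (i) : inner ℝ (nabla (e i) (nabla (e k) (grad I f)) x) (e i x) =
      -α * dirDeriv (e i) (fun y ↦ ricci I y (e k y) (e i y)) x
        + β / 2 * (if k = i then 1 else 0) * dirDeriv (e i) (scalarCurvature I) x := by
    have mr : MDiffAt (fun y ↦ ricci I y (e k y) (e i y)) x :=
      mdifferentiableAt_of_smooth (he.contMDiffAt_ricci k i)
    rw [← he.dirDeriv_inner_left i (mξ k), dirDeriv_congr
      (g := fun y ↦ -α * ricci I y (e k y) (e i y) + (-lam * (if k = i then 1 else 0)
        + β / 2 * (if k = i then 1 else 0) * scalarCurvature I y)),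
      dirDeriv_add (f := fun y ↦ -α * ricci I y (e k y) (e i y)) (mdifferentiableAt_const.mul mr)
        (mdifferentiableAt_const_add_mul _ _ mS),
      dirDeriv_const_mul _ mr, dirDeriv_const_add_mul _ _ mS]
    filter_upwards [he.orthonormal] with y hy
    rw [hf.inner_nabla_grad, orthonormal_iff_ite.1 hy k i]
    ring
  have h2 (i) : inner ℝ (nabla (e i) (nabla (e k) (grad I f)) x) (e i x) =
      inner ℝ (riemann I x (e i x) (e k x) (grad I f x)) (e i x)
        + dirDeriv (e k) (fun y ↦ inner ℝ (nabla (e i) (grad I f) y) (e i y)) x := by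
    rw [he.dirDeriv_inner_left i (mξ i), riemann_eq_curvature (he.smoothAt i) (he.smoothAt k) hξ,
      curvature_eq, nabla_vec_eq_zero (mlieBracket_eq_zero_of_parallel (he.smoothAt i)
      (he.smoothAt k) (he.parallel i) (he.parallel k)), ← inner_add_left]
    congr 1
    abel
  have h3 : ∑ i, dirDeriv (e k) (fun y ↦ inner ℝ (nabla (e i) (grad I f) y) (e i y)) x =
      (-α + β / 2 * Module.finrank ℝ E) * dirDeriv (e k) (scalarCurvature I) x := by
    rw [← (dirDeriv_sum _ fun i _ ↦ mdifferentiableAt_inner I (mξ i) (he.mdifferentiableAt i)).2,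
      dirDeriv_congr (g := fun y ↦ -lam * Module.finrank ℝ E
        + (-α + β / 2 * Module.finrank ℝ E) * scalarCurvature I y),
      dirDeriv_const_add_mul _ _ mS]
    filter_upwards [he.eventually_basis] with y ⟨_, b, hb⟩
    have hl := laplacian_eq_sum (f := f) b
    simp only [hb] at hl
    have ht := hf.trace_eq y
    have hl' : laplacian I f y = ∑ i, inner ℝ (nabla (e i) (grad I f) y) (e i y) := hl
    rw [← hl']
    linarith
  obtain ⟨b, hb⟩ := he.eventually_basis.self_of_nhds.2
  have h4 : ∑ i, inner ℝ (riemann I x (e i x) (e k x) (grad I f x)) (e i x) =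
      ricci I x (e k x) (grad I f x) := by
    rw [ricci_eq_sum b]
    simp only [hb]
  have h5 := Finset.sum_congr (rfl : Finset.univ = Finset.univ) fun i _ ↦ (h1 i).symm.trans (h2 i)
  rw [Finset.sum_add_distrib, Finset.sum_add_distrib, h3, h4, ← Finset.mul_sum] at h5
  simp only [mul_ite, ite_mul, mul_one, mul_zero, zero_mul, Finset.sum_ite_eq, Finset.mem_univ,
    if_true] at h5
  have h6 := he.dirDeriv_scalarCurvature k
  rw [ricci_symm]
  linear_combination 2 * h5 - α * h6

theorem gradient_eq (hf : IsGradientRicciYamabeSoliton I α β lam f) (x : M)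
    (v : TangentSpace I x) :
    (α - β * ((Module.finrank ℝ E : ℝ) - 1)) * inner ℝ (grad I (scalarCurvature I) x) v =
      2 * ricci I x (grad I f x) v := by
  obtain ⟨e, he⟩ := exists_isGeodesicFrame (I := I) x
  have h (k) : (α - β * ((Module.finrank ℝ E : ℝ) - 1)) *
      inner ℝ (grad I (scalarCurvature I) x) (e k x) = 2 * ricci I x (grad I f x) (e k x) := by
    rw [inner_grad]
    exact hf.gradient_frame he k
  have hv := sum_inner_smul_eq he.orthonormal.self_of_nhds v
  simp only [← ricciBilin_apply] at h ⊢
  rw [← hv]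
  simp only [inner_sum, map_sum, inner_smul_right, map_smul, smul_eq_mul, Finset.mul_sum]
  refine Finset.sum_congr rfl fun k _ ↦ ?_
  rw [mul_left_comm, h k]
  ring

theorem laplacian_scalarCurvature (hf : IsGradientRicciYamabeSoliton I α β lam f) (x : M) :
    (α - β * ((Module.finrank ℝ E : ℝ) - 1)) * laplacian I (scalarCurvature I) x =
      inner ℝ (grad I (scalarCurvature I) x) (grad I f x)
        - 2 * (α * ricciNormSq I x
          + scalarCurvature I x * (lam - β / 2 * scalarCurvature I x)) := by
  obtain ⟨e, he⟩ := exists_isGeodesicFrame (I := I) x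
  obtain ⟨b, hb⟩ := he.eventually_basis.self_of_nhds.2
  have mξ : MDiffAt (T% (grad I f)) x :=
    mdifferentiableAt_of_smooth (contMDiffAt_grad (hf.smooth x))
  have mgS : MDiffAt (T% (grad I (scalarCurvature I) : Π x : M, TangentSpace I x)) x :=
    mdifferentiableAt_of_smooth (contMDiffAt_grad (contMDiffAt_scalarCurvature x))
  have mr (k i) : MDiffAt (fun y ↦ ricci I y (e k y) (e i y)) x :=
    mdifferentiableAt_of_smooth (he.contMDiffAt_ricci k i)
  have mξk (k) : MDiffAt (fun y ↦ (inner ℝ (grad I f y) (e k y) : ℝ)) x :=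
    mdifferentiableAt_inner I mξ (he.mdifferentiableAt k)
  have h1 (i) : (α - β * ((Module.finrank ℝ E : ℝ) - 1)) *
      hessian I (scalarCurvature I) x (e i x) (e i x) =
      2 * ∑ k, (inner ℝ (grad I f x) (e k x)
          * dirDeriv (e i) (fun y ↦ ricci I y (e k y) (e i y)) x
        + ricci I x (e k x) (e i x) * (-α * ricci I x (e i x) (e k x)
          - (lam - β / 2 * scalarCurvature I x) * if i = k then 1 else 0)) := by
    have hs := dirDeriv_sum (X := e i) Finset.univ
      (F := fun k y ↦ inner ℝ (grad I f y) (e k y) * ricci I y (e k y) (e i y))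
      fun k _ ↦ (mξk k).mul (mr k i)
    have h2 : dirDeriv (e i) (fun y ↦ (α - β * ((Module.finrank ℝ E : ℝ) - 1)) *
        inner ℝ (grad I (scalarCurvature I) y) (e i y)) x =
        dirDeriv (e i) (fun y ↦ 2 * ∑ k, inner ℝ (grad I f y) (e k y)
          * ricci I y (e k y) (e i y)) x := by
      refine dirDeriv_congr ?_
      filter_upwards [he.orthonormal] with y hy
      rw [hf.gradient_eq, ← ricciBilin_apply]
      conv_lhs => rw [← sum_inner_smul_eq hy (grad I f y)]
      simp [real_inner_comm, ricciBilin_apply]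
    rw [dirDeriv_const_mul _ (mdifferentiableAt_inner I mgS (he.mdifferentiableAt i)),
      he.dirDeriv_inner_left i mgS, dirDeriv_const_mul _ hs.1, hs.2] at h2
    refine Eq.trans h2 ?_
    congr 1
    refine Finset.sum_congr rfl fun k _ ↦ ?_
    rw [dirDeriv_mul (mξk k) (mr k i), he.dirDeriv_inner_left k mξ, hf.inner_nabla_grad,
      he.inner_eq]
  have hlap := laplacian_eq_sum (f := (scalarCurvature I : M → ℝ)) b
  simp only [hb] at hlap
  have hnorm := ricciNormSq_eq_sum b
  simp only [hb] at hnorm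
  have hscal := scalarCurvature_eq_sum b
  simp only [hb] at hscal
  have hgrad : inner ℝ (grad I (scalarCurvature I) x) (grad I f x) =
      ∑ k, inner ℝ (grad I f x) (e k x) *
        (2 * ∑ i, dirDeriv (e i) (fun y ↦ ricci I y (e k y) (e i y)) x) := by
    conv_lhs => rw [← sum_inner_smul_eq he.orthonormal.self_of_nhds (grad I f x)]
    rw [inner_sum]
    refine Finset.sum_congr rfl fun k _ ↦ ?_
    rw [inner_smul_right, ← he.dirDeriv_scalarCurvature, inner_grad, real_inner_comm]
    rfl
  have hterm (i k) : ricci I x (e k x) (e i x) * (-α * ricci I x (e i x) (e k x)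
      - (lam - β / 2 * scalarCurvature I x) * if i = k then 1 else 0) =
      -α * ricci I x (e i x) (e k x) ^ 2
        - (if i = k then ricci I x (e i x) (e i x) else 0)
          * (lam - β / 2 * scalarCurvature I x) := by
    rw [ricci_symm (e k x)]
    split_ifs with h
    · subst h; ring
    · ring
  rw [hlap, Finset.mul_sum]
  simp_rw [h1, hterm, Finset.sum_add_distrib, Finset.sum_sub_distrib, ← Finset.mul_sum,
    ← Finset.sum_mul, mul_add, Finset.sum_add_distrib, mul_sub, Finset.sum_sub_distrib]
  simp only [Finset.sum_ite_eq, Finset.mem_univ, if_true, ← Finset.mul_sum, ← Finset.sum_mul]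
  rw [← hnorm, ← hscal, hgrad, Finset.sum_comm]
  have hcomm : 2 * ∑ k, ∑ i, inner ℝ (grad I f x) (e k x)
      * dirDeriv (e i) (fun y ↦ ricci I y (e k y) (e i y)) x =
    ∑ k, inner ℝ (grad I f x) (e k x)
      * (2 * ∑ i, dirDeriv (e i) (fun y ↦ ricci I y (e k y) (e i y)) x) := by
    simp only [Finset.mul_sum]
    exact Finset.sum_congr rfl fun k _ ↦ Finset.sum_congr rfl fun i _ ↦ by ring
  linear_combination hcomm

end IsGradientRicciYamabeSoliton

end Soliton

end RiemGeom

end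

theorem mainTheorem8 (n : ℕ) {M : Type*} [TopologicalSpace M]
    [ChartedSpace (EuclideanSpace ℝ (Fin n)) M] [IsManifold (𝓡 n) ∞ M]
    [RiemannianBundle (fun x : M ↦ TangentSpace (𝓡 n) x)]
    [IsContMDiffRiemannianBundle (𝓡 n) ∞ (EuclideanSpace ℝ (Fin n))
      (fun x : M ↦ TangentSpace (𝓡 n) x)]
    (α β lam : ℝ) (f : M → ℝ)
    (hf : RiemGeom.IsGradientRicciYamabeSoliton (𝓡 n) α β lam f) :
    (∀ x : M, α * RiemGeom.scalarCurvature (𝓡 n) x + RiemGeom.laplacian (𝓡 n) f x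
        + (lam - β / 2 * RiemGeom.scalarCurvature (𝓡 n) x) * n = 0) ∧
    (∀ (x : M) (v : TangentSpace (𝓡 n) x),
      (α - β * ((n : ℝ) - 1)) *
          inner ℝ (RiemGeom.grad (𝓡 n) (RiemGeom.scalarCurvature (𝓡 n)) x) v
        = 2 * RiemGeom.ricci (𝓡 n) x (RiemGeom.grad (𝓡 n) f x) v) ∧
    (∀ x : M,
      (α - β * ((n : ℝ) - 1)) *
          RiemGeom.laplacian (𝓡 n) (RiemGeom.scalarCurvature (𝓡 n) : M → ℝ) x
        = inner ℝ (RiemGeom.grad (𝓡 n) (RiemGeom.scalarCurvature (𝓡 n)) x)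
            (RiemGeom.grad (𝓡 n) f x)
          - 2 * (α * RiemGeom.ricciNormSq (𝓡 n) x
            + RiemGeom.scalarCurvature (𝓡 n) x *
              (lam - β / 2 * RiemGeom.scalarCurvature (𝓡 n) x))) := by
  have hn : (Module.finrank ℝ (EuclideanSpace ℝ (Fin n)) : ℝ) = n := by simp
  refine ⟨fun x ↦ ?_, fun x v ↦ ?_, fun x ↦ ?_⟩
  · rw [← hn]
    exact hf.trace_eq x
  · rw [← hn]
    exact hf.gradient_eq x v
  · rw [← hn]
    exact hf.laplacian_scalarCurvature x
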